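/- **Conventions.** An arithmetic circuit over $\mathbb{C}$ starts from its inputs and arbitrary complex constants (both free) and performs a sequence of additions, subtractions and multiplications; its operation count is the number of these operations. Let $\omega$ be the exponent of matrix multiplication over $\mathbb{C}$: the infimum of all real $\tau$ such that, for some constant $b$ and all $n$, two $n\times n$ complex matrices can be multiplied by an arithmetic circuit with at most $b\,n^{\tau}$ operations. For a finite group $G$ and a complete set $\mathrm{Irr}(G)$ of irreducible complex matrix representations (one from each isomorphism class, each written in some basis), the generalized DFT of $G$ with respect to $\mathrm{Irr}(G)$ is the linear map that sends $(c_g)_{g\in G}\in\mathbb{C}^G$ to the entries of the diagonal blocks of $$\sum_{g\in G} c_g\bigoplus_{\rho\in \mathrm{Irr}(G)}\rho(g).$$ For a field $\mathbb{F}_q$ with $q$ elements and $n=2m$ with $m\ge 0$, let $O_n(\mathbb{F}_q)$ be the plus-type orthogonal group $$O_n(\mathbb{F}_q)=\{A\in \mathrm{GL}_n(\mathbb{F}_q) : A^{T}QA=Q\},\qquad Q=\begin{pmatrix}0&J\\ J&0\end{pmatrix},$$ where $J$ is the $m\times m$ matrix with ones on the antidiagonal and zeros elsewhere. **Theorem.**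 For every real $\varepsilon>0$ there is a constant $c_\varepsilon$, depending on $\varepsilon$ only, such that for every even $n\ge 0$ and every odd prime power $q$, the group $G=O_n(\mathbb{F}_q)$ has a complete set of irreducible complex matrix representations, and for every such set $\mathrm{Irr}(G)$ the generalized DFT of $G$ with respect to $\mathrm{Irr}(G)$ is computed by an arithmetic circuit with at most $c_\varepsilon\,|G|^{\omega/2+\varepsilon}$ operations. -/

import Mathlib

namespace GenDFT

/-! ### Arithmetic circuits over the complex numbers -/

/-- The operands available to a new gate of a circuit that reads inputs indexed by `ι` and already
has `s` gates: an input, a complex constant, or the value of an earlier gate. -/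
inductive Operand (ι : Type*) (s : ℕ) where
  | input (i : ι)
  | const (z : ℂ)
  | gate (k : Fin s)

/-- The arithmetic operations, each of which costs one. -/
inductive Op where
  | add
  | sub
  | mul

/-- The function on complex numbers performed by an operation. -/
def Op.apply : Op → ℂ → ℂ → ℂ
  | .add, x, y => x + y
  | .sub, x, y => x - y
  | .mul, x, y => x * y

/-- An arithmetic circuit (straight-line program) over `ℂ` with inputs indexed by `ι`. The index
`s` is the number of gates, that is, the number of arithmetic operations that are performed. -/
inductive Circuit (ι : Type*) : ℕ → Type _ where
  | nil : Circuit ι 0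
  | snoc {s : ℕ} (C : Circuit ι s) (op : Op) (u v : Operand ι s) : Circuit ι (s + 1)

/-- The value of an operand, given the inputs `x` and the values `w` of the existing gates. -/
def Operand.eval {ι : Type*} {s : ℕ} (x : ι → ℂ) (w : Fin s → ℂ) : Operand ι s → ℂ
  | .input i => x i
  | .const z => z
  | .gate k => w k

/-- The values of all gates of a circuit on the input `x`. -/
def Circuit.eval {ι : Type*} (x : ι → ℂ) : {s : ℕ} → Circuit ι s → Fin s → ℂ
  | _, .nil => Fin.elim0
  | _, .snoc C op u v =>
      Fin.snoc (α := fun _ => ℂ) (C.eval x)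
        (op.apply (u.eval x (C.eval x)) (v.eval x (C.eval x)))

/-- `ComputableWith f s`: some arithmetic circuit with `s` operations computes all the coordinates
of the map `f`. -/
def ComputableWith {ι κ : Type*} (f : (ι → ℂ) → (κ → ℂ)) (s : ℕ) : Prop :=
  ∃ (C : Circuit ι s) (out : κ → Operand ι s),
    ∀ (x : ι → ℂ) (j : κ), (out j).eval x (C.eval x) = f x j

/-! ### The exponent of matrix multiplication -/

/-- Multiplication of two `n × n` matrices, as a map from the `2 * n ^ 2` entries of the two
factors to the `n ^ 2` entries of their product. -/
def matMul (n : ℕ) (x : (Fin n × Fin n) ⊕ (Fin n × Fin n) → ℂ) : Fin n × Fin n → ℂ :=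
  fun p =>
    ((Matrix.of fun i j => x (Sum.inl (i, j))) * (Matrix.of fun i j => x (Sum.inr (i, j))) :
      Matrix (Fin n) (Fin n) ℂ) p.1 p.2

/-- The exponent `ω` of matrix multiplication over `ℂ`: the infimum of the real numbers `τ` such
that `n × n` matrices can be multiplied with `O(n ^ τ)` arithmetic operations. -/
noncomputable def omega : ℝ :=
  sInf {τ : ℝ | ∃ b : ℝ, ∀ n : ℕ, ∃ s : ℕ, (s : ℝ) ≤ b * (n : ℝ) ^ τ ∧ ComputableWith (matMul n) s}

/-! ### Generalized discrete Fourier transforms -/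

/-- The representation on column vectors that is given by a matrix representation. -/
noncomputable def toRep {G : Type*} [Group G] {d : ℕ} (ρ : G →* Matrix (Fin d) (Fin d) ℂ) :
    Representation ℂ G (Fin d → ℂ) :=
  ((Matrix.toLinAlgEquiv' : Matrix (Fin d) (Fin d) ℂ ≃ₐ[ℂ] ((Fin d → ℂ) →ₗ[ℂ] (Fin d → ℂ))) :
    Matrix (Fin d) (Fin d) ℂ →* ((Fin d → ℂ) →ₗ[ℂ] (Fin d → ℂ))).comp ρ

/-- A complete set of irreducible complex representations of `G`, each written in some basis:
finitely many irreducible matrix representations, such that every irreducible matrix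
representation of `G` is isomorphic to exactly one of them. -/
structure IrrepSystem (G : Type*) [Group G] where
  index : Type
  [fintype : Fintype index]
  dim : index → ℕ
  rep : ∀ i, G →* Matrix (Fin (dim i)) (Fin (dim i)) ℂ
  irreducible : ∀ i, (toRep (rep i)).IsIrreducible
  inequivalent : ∀ i j, Nonempty ((toRep (rep i)).Equiv (toRep (rep j))) → i = j
  complete : ∀ (d : ℕ) (σ : G →* Matrix (Fin d) (Fin d) ℂ), (toRep σ).IsIrreducible →
    ∃ i, Nonempty ((toRep σ).Equiv (toRep (rep i)))

/-- The generalized DFT of `G` with respect to a complete set of irreducible representations: it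
maps the coefficients of `c ∈ ℂ[G]` to the entries of all the diagonal blocks of
`∑ g, c g • ⨁ i, ρ i g`. -/
noncomputable def dft {G : Type*} [Group G] [Fintype G] (R : IrrepSystem G) (c : G → ℂ) :
    (Σ i : R.index, Fin (R.dim i) × Fin (R.dim i)) → ℂ :=
  fun p => (∑ g : G, c g • R.rep p.1 g) p.2.1 p.2.2

/-! ### The orthogonal group of plus type -/

/-- The `m × m` matrix `J` with ones on the antidiagonal and zeros elsewhere. -/
def antidiag (m : ℕ) (K : Type*) [Field K] : Matrix (Fin m) (Fin m) K :=
  Matrix.of fun i j => if j = Fin.rev i then 1 else 0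

/-- The `2m × 2m` matrix with block rows `(0, J)` and `(J, 0)`. -/
def plusForm (m : ℕ) (K : Type*) [Field K] : Matrix (Fin m ⊕ Fin m) (Fin m ⊕ Fin m) K :=
  Matrix.fromBlocks 0 (antidiag m K) (antidiag m K) 0

/-- The orthogonal group of plus type in dimension `2m` over `K`: the invertible matrices `A` with
`Aᵀ Q A = Q`, where `Q` is `plusForm m K`. -/
def plusOrthogonalGroup (m : ℕ) (K : Type*) [Field K] :
    Subgroup (Matrix.GeneralLinearGroup (Fin m ⊕ Fin m) K) where
  carrier := {A | (A : Matrix (Fin m ⊕ Fin m) (Fin m ⊕ Fin m) K).transpose * plusForm m K *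
    (A : Matrix (Fin m ⊕ Fin m) (Fin m ⊕ Fin m) K) = plusForm m K}
  one_mem' := by simp
  mul_mem' := by
    intro A B hA hB
    simp only [Set.mem_ofPred_eq, Units.val_mul, Matrix.transpose_mul] at hA hB ⊢
    calc _ = B.val.transpose * (A.val.transpose * plusForm m K * A.val) * B.val := by
            simp only [Matrix.mul_assoc]
      _ = _ := by rw [hA, hB]
  inv_mem' := by
    intro A hA
    simp only [Set.mem_ofPred_eq] at hA ⊢
    have h1 : A.val * (A⁻¹).val = 1 := A.mul_inv
    have h2 : (A⁻¹).val.transpose * A.val.transpose = 1 := by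
      rw [← Matrix.transpose_mul, h1, Matrix.transpose_one]
    calc (A⁻¹).val.transpose * plusForm m K * (A⁻¹).val
        = (A⁻¹).val.transpose * (A.val.transpose * plusForm m K * A.val) * (A⁻¹).val := by rw [hA]
      _ = ((A⁻¹).val.transpose * A.val.transpose) * plusForm m K * (A.val * (A⁻¹).val) := by
            simp only [Matrix.mul_assoc]
      _ = plusForm m K := by rw [h1, h2, Matrix.one_mul, Matrix.mul_one]

noncomputable instance (m : ℕ) (K : Type*) [Field K] [Fintype K] :
    Fintype (plusOrthogonalGroup m K) :=
  have : Finite (Matrix.GeneralLinearGroup (Fin m ⊕ Fin m) K) :=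
    Finite.of_injective _ Units.val_injective
  Fintype.ofFinite _

end GenDFT

open GenDFT

/-! Sums over a set x·A·y·K, with A a subset of a group H, are cheap once DFTs of H and K are. In
ρ(x a y k) the restrictions of ρ to H and to K are block diagonal in suitable bases, so the sum of
the c·ρ(x a y k) is assembled from the (H × K)-transform by multiplications with constant matrices.
Sorting the block products by the pair of irreducibles of H and K makes them rectangular products of
a variable square matrix with a constant matrix. The squares of the dimensions add up to at most the
group order and t ↦ t^(τ/2) is superadditive for τ ≥ 2, so all of this costs O((|H||K|)^(τ/2) +
|G|^(τ/2)), besides |A| DFTs of K and |K| DFTs of H. `FastDFT.of_cover` is the resulting reduction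
for a group covered by several such sets.

For the orthogonal group the sets are translates of the big cell B w U, with B the Borel subgroup, U
its unipotent radical and w the order-reversing Weyl element. The product map B × U → B w U is
injective and |G| ≤ 3^m |B||U|, so a greedy choice of about 3^m log |G| translates covers G
(`exists_translates_cover`). Here B = TU with T a power of the cyclic group Kˣ, which Bluestein's
algorithm handles, and U is a p-group of exponent at most (2m+1)p, which is climbed by a chain of
subgroups of index p with powers of one element as transversals (`fastDFT_pGroup`). Along these
chains the constants grow additively.

The total overhead is a constant times 3^m (2m+1)^α (log |G| + 1)². Since |G| ≥ 3^(m(m-1)), it is at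
most a constant times |G|^(ε/2), uniformly in m and q; the other ε/2 pays for approaching ω and for
the logarithm in the FFT. -/

/-! ### Cost calculus for circuits -/

/-- Some arithmetic circuit with at most `r` operations computes `f`. -/
def CostLE {ι κ : Type*} (f : (ι → ℂ) → (κ → ℂ)) (r : ℝ) : Prop :=
  ∃ s : ℕ, (s : ℝ) ≤ r ∧ ComputableWith f s

theorem CostLE.mono {ι κ : Type*} {f : (ι → ℂ) → (κ → ℂ)} {r t : ℝ} (h : CostLE f r)
    (hrt : r ≤ t) : CostLE f t := by
  obtain ⟨s, hs, hf⟩ := h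
  exact ⟨s, hs.trans hrt, hf⟩

theorem CostLE.congr {ι κ : Type*} {f g : (ι → ℂ) → (κ → ℂ)} {r t : ℝ} (h : CostLE f r)
    (hfg : ∀ x j, g x j = f x j) (hrt : r ≤ t) : CostLE g t := by
  rw [show g = f from funext fun x => funext fun j => hfg x j]
  exact h.mono hrt

theorem CostLE.nonneg {ι κ : Type*} {f : (ι → ℂ) → (κ → ℂ)} {r : ℝ} (h : CostLE f r) : 0 ≤ r := by
  obtain ⟨s, hs, -⟩ := h
  exact (Nat.cast_nonneg s).trans hs

/-- Substitute the outputs of a circuit with `s` gates for the inputs of an operand. -/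
def GenDFT.Operand.subst {ι κ : Type*} {s t : ℕ} (out : κ → Operand ι s) :
    Operand κ t → Operand ι (s + t)
  | .input j => match out j with
    | .input i => .input i
    | .const z => .const z
    | .gate k => .gate (Fin.castAdd t k)
  | .const z => .const z
  | .gate k => .gate (Fin.natAdd s k)

theorem GenDFT.Operand.eval_subst {ι κ : Type*} {s t : ℕ} (out : κ → Operand ι s)
    (u : Operand κ t) (x : ι → ℂ) (v : Fin s → ℂ) (w : Fin t → ℂ) :
    (u.subst out).eval x (Fin.append v w) = u.eval (fun j => (out j).eval x v) w := by
  cases u with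
  | input j => simp only [Operand.subst]; cases h : out j <;> simp [Operand.eval, h]
  | const z => rfl
  | gate k => simp [Operand.subst, Operand.eval]

/-- Feed the outputs of the circuit `C` into the circuit `D`. -/
def GenDFT.Circuit.append {ι κ : Type*} {s : ℕ} (C : Circuit ι s) (out : κ → Operand ι s) :
    {t : ℕ} → Circuit κ t → Circuit ι (s + t)
  | _, .nil => C
  | _, .snoc D op u v => .snoc (C.append out D) op (u.subst out) (v.subst out)

theorem GenDFT.Circuit.eval_append {ι κ : Type*} {s : ℕ} (C : Circuit ι s)
    (out : κ → Operand ι s) (x : ι → ℂ) {t : ℕ} (D : Circuit κ t) :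
    (C.append out D).eval x =
      Fin.append (C.eval x) (D.eval fun j => (out j).eval x (C.eval x)) := by
  induction D with
  | nil => ext i; simp [Circuit.append, Circuit.eval]
  | snoc D op u v ih =>
    simp only [Circuit.append, Circuit.eval, Fin.append_snoc, ih, Operand.eval_subst]

theorem CostLE.comp {ι κ μ : Type*} {f : (ι → ℂ) → (κ → ℂ)} {g : (κ → ℂ) → (μ → ℂ)} {r t : ℝ}
    (hg : CostLE g t) (hf : CostLE f r) : CostLE (fun x => g (f x)) (r + t) := by
  obtain ⟨s, hs, C, out, hC⟩ := hf
  obtain ⟨s', hs', D, out', hD⟩ := hg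
  refine ⟨s + s', by push_cast; linarith, C.append out D, fun j => (out' j).subst out, ?_⟩
  intro x j
  rw [Circuit.eval_append, Operand.eval_subst, hD]
  exact congrArg (fun y => g y j) (funext fun k => hC x k)

/-- Selecting inputs and constants is free. -/
theorem CostLE.select {ι κ : Type*} (u : κ → ι ⊕ ℂ) :
    CostLE (fun (x : ι → ℂ) j => Sum.elim x id (u j)) 0 := by
  refine ⟨0, by simp, .nil, fun j => (u j).elim .input .const, fun x j => ?_⟩
  cases h : u j <;> simp [Operand.eval, h]

theorem CostLE.reindex {ι κ : Type*} (u : κ → ι) :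
    CostLE (fun (x : ι → ℂ) j => x (u j)) 0 :=
  CostLE.select fun j => Sum.inl (u j)

theorem CostLE.out {ι κ μ : Type*} {f : (ι → ℂ) → (κ → ℂ)} {r : ℝ}
    (hf : CostLE f r) (u : μ → κ) : CostLE (fun x j => f x (u j)) r := by
  simpa using (CostLE.reindex u).comp hf

theorem CostLE.inp {ι ι' κ : Type*} {f : (ι → ℂ) → (κ → ℂ)} {r : ℝ}
    (hf : CostLE f r) (u : ι → ι') : CostLE (fun x : ι' → ℂ => f fun i => x (u i)) r := by
  simpa using hf.comp (CostLE.reindex u)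

theorem CostLE.keep {ι κ : Type*} {f : (ι → ℂ) → (κ → ℂ)} {r : ℝ}
    (hf : CostLE f r) : CostLE (fun x => Sum.elim (f x) x) r := by
  obtain ⟨s, hs, C, out, hC⟩ := hf
  refine ⟨s, hs, C, Sum.elim out .input, fun x j => ?_⟩
  cases j with
  | inl j => exact hC x j
  | inr i => rfl

/-- Circuits are sequential: `f` runs first with its inputs retained, then `g` runs on the retained
inputs. Hence costs add. -/
theorem CostLE.pair {ι κ μ : Type*} {f : (ι → ℂ) → (κ → ℂ)} {g : (ι → ℂ) → (μ → ℂ)} {r t : ℝ}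
    (hf : CostLE f r) (hg : CostLE g t) : CostLE (fun x => Sum.elim (f x) (g x)) (r + t) := by
  have h := ((hg.inp (Sum.inr : ι → κ ⊕ ι)).keep.comp hf.keep).out
    (Sum.elim (fun k => Sum.inr (Sum.inl k)) Sum.inl : κ ⊕ μ → μ ⊕ (κ ⊕ ι))
  convert h using 3 with x j
  cases j <;> simp

theorem CostLE.of_isEmpty {ι κ : Type*} [IsEmpty κ] (f : (ι → ℂ) → (κ → ℂ)) : CostLE f 0 :=
  ⟨0, by simp, .nil, isEmptyElim, fun _ j => isEmptyElim j⟩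

theorem CostLE.sigma {ι A : Type*} [Fintype A] {κ : A → Type*}
    {f : ∀ a, (ι → ℂ) → (κ a → ℂ)} {r : A → ℝ} (h : ∀ a, CostLE (f a) (r a)) :
    CostLE (fun x (p : Σ a, κ a) => f p.1 x p.2) (∑ a, r a) := by
  classical
  have key : ∀ S : Finset A, CostLE (fun x (p : Σ a : S, κ a) => f p.1 x p.2) (∑ a ∈ S, r a) := by
    intro S
    induction S using Finset.induction with
    | empty =>
      have : IsEmpty (Σ a : (∅ : Finset A), κ a) := ⟨fun p => (Finset.notMem_empty _ p.1.2).elim⟩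
      simpa using CostLE.of_isEmpty _
    | insert a S ha ih =>
      rw [Finset.sum_insert ha]
      have h2 := ((h a).pair ih).out
        (fun p : (Σ b : (insert a S : Finset A), κ b) =>
          if hb : p.1.1 = a then Sum.inl (hb ▸ p.2) else
            Sum.inr ⟨⟨p.1.1, (Finset.mem_insert.1 p.1.2).resolve_left hb⟩, p.2⟩)
      convert h2 using 3 with x p
      obtain ⟨⟨b, hb⟩, k⟩ := p
      dsimp only
      split_ifs with hba
      · subst hba; rfl
      · rfl
  exact (key Finset.univ).out
    fun p : (Σ a, κ a) => (⟨⟨p.1, Finset.mem_univ _⟩, p.2⟩ : Σ a : (Finset.univ : Finset A), κ a)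

/-- Independent computations, each on its own outputs. -/
theorem CostLE.family {ι A κ : Type*} [Fintype A] {μ : A → Type*}
    {f : ∀ a, (ι → ℂ) → (μ a → ℂ)} {r : A → ℝ} (h : ∀ a, CostLE (f a) (r a))
    {F : (ι → ℂ) → (κ → ℂ)} (u : ∀ _ : κ, Σ a, μ a) (hF : ∀ x j, F x j = f (u j).1 x (u j).2) :
    CostLE F (∑ a, r a) := by
  convert (CostLE.sigma h).out u using 3 with x j
  exact hF x j

theorem CostLE.coordwise {ι κ : Type*} [Fintype κ] {F : (ι → ℂ) → (κ → ℂ)} {r : ℝ}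
    (h : ∀ j, CostLE (fun x (_ : Unit) => F x j) r) : CostLE F (Fintype.card κ * r) := by
  have := CostLE.family (F := F) h (fun j => ⟨j, ()⟩) fun _ _ => rfl
  simpa using this

theorem CostLE.op {ι : Type*} (o : Op) (u v : ι ⊕ ℂ) :
    CostLE (fun (x : ι → ℂ) (_ : Unit) => o.apply (Sum.elim x id u) (Sum.elim x id v)) 1 := by
  refine ⟨1, by simp, .snoc .nil o (u.elim .input .const) (v.elim .input .const),
    fun _ => .gate 0, fun x j => ?_⟩
  have : ∀ u : ι ⊕ ℂ, Operand.eval x (Circuit.eval x Circuit.nil)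
    (u.elim Operand.input Operand.const) = Sum.elim x id u := by
    rintro (u | u) <;> rfl
  dsimp only
  rw [← this u, ← this v]
  exact Fin.snoc_last (α := fun _ => ℂ) (n := 0) _ (Circuit.eval x Circuit.nil)

theorem CostLE.scale {ι κ : Type*} [Fintype κ] (u : κ → ι) (c : κ → ℂ) :
    CostLE (fun (x : ι → ℂ) j => c j * x (u j)) (Fintype.card κ) := by
  simpa using CostLE.coordwise (F := fun (x : ι → ℂ) j => c j * x (u j)) (r := 1)
    fun j => CostLE.op .mul (Sum.inr (c j)) (Sum.inl (u j))

theorem CostLE.add_coord {ι κ : Type*} [Fintype κ] (u v : κ → ι) :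
    CostLE (fun (x : ι → ℂ) j => x (u j) + x (v j)) (Fintype.card κ) := by
  simpa using CostLE.coordwise (F := fun (x : ι → ℂ) j => x (u j) + x (v j)) (r := 1)
    fun j => CostLE.op .add (Sum.inl (u j)) (Sum.inl (v j))

theorem CostLE.add {ι κ : Type*} [Fintype κ] {f g : (ι → ℂ) → (κ → ℂ)} {r t : ℝ}
    (hf : CostLE f r) (hg : CostLE g t) :
    CostLE (fun x j => f x j + g x j) (r + t + Fintype.card κ) := by
  simpa using (CostLE.add_coord (Sum.inl : κ → κ ⊕ κ) Sum.inr).comp (hf.pair hg)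

theorem CostLE.zero {ι κ : Type*} : CostLE (fun (_ : ι → ℂ) (_ : κ) => 0) 0 :=
  CostLE.select fun _ => Sum.inr 0

theorem CostLE.sum {ι κ A : Type*} [Fintype κ] (S : Finset A)
    {f : A → (ι → ℂ) → (κ → ℂ)} {r : A → ℝ} (h : ∀ a ∈ S, CostLE (f a) (r a)) :
    CostLE (fun x j => ∑ a ∈ S, f a x j) (∑ a ∈ S, (r a + Fintype.card κ)) := by
  classical
  induction S using Finset.induction with
  | empty => simpa using CostLE.zero
  | insert a S ha ih =>
    simp only [Finset.sum_insert ha]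
    exact ((h a (by simp)).add (ih fun b hb => h b (by simp [hb]))).mono (by linarith)

/-! ### Matrix multiplication: exponent at least two, rectangular products with a constant factor -/

/-- An explicit bound, with exponent at least two, for the cost of multiplying square matrices. -/
structure MatMulBound (b τ : ℝ) : Prop where
  two_le : 2 ≤ τ
  nonneg : 0 ≤ b
  cost : ∀ n : ℕ, CostLE (matMul n) (b * (n : ℝ) ^ τ)

/-- On t times a suitable pair of matrix units, the product has t² at position p and zeros
elsewhere. An output quadratic in t is neither an input nor a constant, so it is a gate, and two
positions cannot share a gate because their values differ at t = 1. -/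
theorem sq_le_of_computableWith_matMul {n s : ℕ} (h : ComputableWith (matMul n) s) :
    n ^ 2 ≤ s := by
  obtain ⟨C, out, hC⟩ := h
  rcases Nat.eq_zero_or_pos n with rfl | hn
  · simp
  let z : Fin n := ⟨0, hn⟩
  let X : Fin n × Fin n → (Fin n × Fin n) ⊕ (Fin n × Fin n) → ℂ := fun p =>
    Sum.elim (fun q => if q = (p.1, z) then 1 else 0) (fun q => if q = (z, p.2) then 1 else 0)
  have hX : ∀ (t : ℂ) p q, matMul n (fun i => t * X p i) q = if p = q then t ^ 2 else 0 := by
    rintro t ⟨a, b⟩ ⟨c, d⟩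
    simp only [matMul, Matrix.mul_apply, Matrix.of_apply, X, Sum.elim_inl, Sum.elim_inr,
      Prod.mk.injEq]
    rw [Finset.sum_eq_single z]
    · have hca : (c = a) = (a = c) := propext eq_comm
      have hdb : (d = b) = (b = d) := propext eq_comm
      simp only [hca, hdb]
      by_cases h1 : a = c <;> by_cases h2 : b = d <;> simp [h1, h2, sq]
    · intro k _ hk; simp [hk]
    · simp
  have hgate : ∀ p, ∃ k, out p = .gate k := by
    intro p
    have h0 := hC (fun i => 0 * X p i) p
    have h1 := hC (fun i => 1 * X p i) p
    have h2 := hC (fun i => 2 * X p i) p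
    rw [hX] at h0 h1 h2
    cases ho : out p with
    | input i =>
      simp only [ho, Operand.eval, if_true] at h1 h2
      rw [one_mul] at h1
      rw [h1] at h2
      norm_num at h2
    | const c =>
      simp only [ho, Operand.eval, if_true] at h0 h1
      rw [h0] at h1
      norm_num at h1
    | gate k => exact ⟨k, rfl⟩
  choose k hk using hgate
  have hinj : Function.Injective k := by
    intro p q hpq
    by_contra hne
    have h1 := hC (fun i => 1 * X p i) p
    have h2 := hC (fun i => 1 * X p i) q
    rw [hX, hk] at h1 h2
    rw [← hpq, h1] at h2
    simp [hne] at h2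
  simpa [sq] using Fintype.card_le_of_injective k hinj

theorem two_le_of_matMul_bound {τ b : ℝ}
    (h : ∀ n : ℕ, ∃ s : ℕ, (s : ℝ) ≤ b * (n : ℝ) ^ τ ∧ ComputableWith (matMul n) s) : 2 ≤ τ := by
  by_contra! hlt
  have ht : Filter.Tendsto (fun n : ℕ => (n : ℝ) ^ (2 - τ)) Filter.atTop Filter.atTop :=
    (tendsto_rpow_atTop (by linarith)).comp tendsto_natCast_atTop_atTop
  obtain ⟨n, hn, hn1⟩ := ((ht.eventually_gt_atTop b).and (Filter.eventually_ge_atTop 1)).exists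
  obtain ⟨s, hs, hc⟩ := h n
  have h2 : ((n : ℝ)) ^ (2 : ℝ) ≤ s := by
    rw [Real.rpow_two]; exact_mod_cast sq_le_of_computableWith_matMul hc
  have hn0 : (0 : ℝ) < n := by exact_mod_cast hn1
  have h3 : (n : ℝ) ^ (2 : ℝ) = (n : ℝ) ^ (2 - τ) * (n : ℝ) ^ τ := by
    rw [← Real.rpow_add hn0]; ring_nf
  have h4 : b * (n : ℝ) ^ τ < (n : ℝ) ^ (2 - τ) * (n : ℝ) ^ τ :=
    mul_lt_mul_of_pos_right hn (Real.rpow_pos_of_pos hn0 _)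
  linarith

/-- The schoolbook algorithm. -/
theorem matMul_cost_cube (n : ℕ) : CostLE (matMul n) (2 * (n : ℝ) ^ (3 : ℝ)) := by
  have h : ∀ p : Fin n × Fin n, CostLE (fun x (_ : Unit) => matMul n x p) (n * 2) := by
    intro p
    have := CostLE.sum (κ := Unit) (Finset.univ : Finset (Fin n)) (r := fun _ => 1)
      (f := fun k (x : (Fin n × Fin n) ⊕ (Fin n × Fin n) → ℂ) _ =>
        x (Sum.inl (p.1, k)) * x (Sum.inr (k, p.2)))
      (fun k _ => CostLE.op .mul (Sum.inl (Sum.inl (p.1, k))) (Sum.inl (Sum.inr (k, p.2))))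
    refine this.mono ?_
    simp; linarith
  refine (CostLE.coordwise h).mono (le_of_eq ?_)
  simp
  ring

/-- The infimum ω need not be attained, hence the δ. Some admissible exponent lies below ω + δ, and
it may be raised because n ≥ 1; for n = 0 both powers vanish. -/
theorem exists_matMulBound {δ : ℝ} (hδ : 0 < δ) : ∃ b, MatMulBound b (omega + δ) := by
  set S := {τ : ℝ | ∃ b : ℝ, ∀ n : ℕ, ∃ s : ℕ,
    (s : ℝ) ≤ b * (n : ℝ) ^ τ ∧ ComputableWith (matMul n) s} with hS
  have hne : S.Nonempty := ⟨3, 2, matMul_cost_cube⟩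
  have hom : omega = sInf S := rfl
  obtain ⟨τ, ⟨b, hb⟩, hτ⟩ := exists_lt_of_csInf_lt hne (show sInf S < sInf S + δ by linarith)
  have h2 := two_le_of_matMul_bound hb
  rw [← hom] at hτ
  refine ⟨max b 0, h2.trans hτ.le, le_max_right _ _, fun n => ?_⟩
  obtain ⟨s, hs, hc⟩ := hb n
  refine ⟨s, hs.trans ?_, hc⟩
  rcases Nat.eq_zero_or_pos n with rfl | hn
  · rw [Nat.cast_zero, Real.zero_rpow (by linarith), Real.zero_rpow (by linarith)]; simp
  · have hn1 : (1 : ℝ) ≤ n := by exact_mod_cast hn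
    gcongr
    · exact le_max_left _ _

/-- The columns of the constant matrix are cut into `l / a + 1` slabs of width at most `a`, and each
slab is one padded `a × a` product. The term with a² covers few columns, the term with a·l covers
many. -/
theorem MatMulBound.mul_const {b τ : ℝ} (h : MatMulBound b τ) {I J L : Type*} [Fintype I]
    [Fintype J] [Fintype L] {a : ℕ} (hI : Fintype.card I ≤ a) (hJ : Fintype.card J ≤ a)
    (M : J → L → ℂ) :
    CostLE (fun (x : I × J → ℂ) (p : I × L) => ∑ j, x (p.1, j) * M j p.2)
      (2 * b * ((a : ℝ) ^ 2) ^ (τ / 2) + b * (a * Fintype.card L : ℝ) ^ (τ / 2)) := by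
  classical
  have h2 := h.two_le
  have hb := h.nonneg
  rcases Nat.eq_zero_or_pos a with rfl | ha
  · have : IsEmpty I := Fintype.card_eq_zero_iff.1 (by omega)
    exact (CostLE.of_isEmpty _).mono (by positivity)
  set l := Fintype.card L with hl
  let eI : I ↪ Fin a := (Fintype.equivFin I).toEmbedding.trans (Fin.castLEEmb hI)
  let eJ : J ↪ Fin a := (Fintype.equivFin J).toEmbedding.trans (Fin.castLEEmb hJ)
  let eL : L ≃ Fin l := Fintype.equivFin L
  let N := l / a + 1
  have hblock : ∀ t : Fin N, CostLE (fun (x : I × J → ℂ) (p : I × {q : L // (eL q : ℕ) / a = t}) =>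
      ∑ j, x (p.1, j) * M j p.2) (b * (a : ℝ) ^ τ) := by
    intro t
    let vL : I × J → Fin a × Fin a := fun p => (eI p.1, eJ p.2)
    let vR : J × {q : L // (eL q : ℕ) / a = t} → Fin a × Fin a :=
      fun p => (eJ p.1, ⟨(eL p.2 : ℕ) % a, Nat.mod_lt _ ha⟩)
    have hvL : Function.Injective vL := fun p p' hp =>
      Prod.ext (eI.injective (Prod.mk.inj hp).1) (eJ.injective (Prod.mk.inj hp).2)
    have hvR : Function.Injective vR := by
      rintro ⟨j, q, hq⟩ ⟨j', q', hq'⟩ hp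
      obtain ⟨h1, h2⟩ := Prod.mk.inj hp
      have h3 : (eL q : ℕ) = eL q' := by
        rw [← Nat.div_add_mod (eL q : ℕ) a, ← Nat.div_add_mod (eL q' : ℕ) a, hq, hq',
          Fin.mk.inj h2]
      exact Prod.ext (eJ.injective h1) (Subtype.ext (eL.injective (Fin.ext h3)))
    -- Inputs and the constants of the slab are placed by the embeddings; all other positions are
    -- padded with 0.
    let u : (Fin a × Fin a) ⊕ (Fin a × Fin a) → (I × J) ⊕ ℂ := Sum.elim
      (Function.extend vL Sum.inl fun _ => Sum.inr 0)
      (Function.extend vR (fun p => Sum.inr (M p.1 p.2)) fun _ => Sum.inr 0)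
    have h1 := ((h.cost a).comp (CostLE.select u)).out
      (fun p : I × {q : L // (eL q : ℕ) / a = t} =>
        ((eI p.1, ⟨(eL p.2 : ℕ) % a, Nat.mod_lt _ ha⟩) : Fin a × Fin a))
    rw [zero_add] at h1
    convert h1 using 3 with x p
    obtain ⟨i, q, hq⟩ := p
    simp only [matMul, Matrix.mul_apply, Matrix.of_apply]
    have hz : ∀ k ∈ Finset.univ, k ∉ Finset.univ.map eJ →
        Sum.elim x id (u (Sum.inl (eI i, k))) *
          Sum.elim x id (u (Sum.inr (k, ⟨(eL q : ℕ) % a, Nat.mod_lt _ ha⟩))) = 0 := by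
      intro k _ hk
      have : ¬ ∃ p, vL p = (eI i, k) := by
        rintro ⟨p, hp⟩
        exact hk (Finset.mem_map.2 ⟨p.2, Finset.mem_univ _, (Prod.mk.inj hp).2⟩)
      simp only [u, Sum.elim_inl]
      rw [Function.extend_apply' _ _ _ this]
      simp
    rw [← Finset.sum_subset (Finset.subset_univ (Finset.univ.map eJ)) hz, Finset.sum_map]
    refine Finset.sum_congr rfl fun j _ => ?_
    have hu1 : u (Sum.inl (eI i, eJ j)) = Sum.inl (i, j) :=
      hvL.extend_apply Sum.inl (fun _ => Sum.inr 0) (i, j)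
    have hu2 : u (Sum.inr (eJ j, ⟨(eL q : ℕ) % a, Nat.mod_lt _ ha⟩)) = Sum.inr (M j q) :=
      hvR.extend_apply (fun p => Sum.inr (M p.1 p.2)) (fun _ => Sum.inr 0) (j, ⟨q, hq⟩)
    rw [hu1, hu2]
    rfl
  have hfam := CostLE.family hblock
    (F := fun (x : I × J → ℂ) (p : I × L) => ∑ j, x (p.1, j) * M j p.2)
    (fun p => ⟨⟨(eL p.2 : ℕ) / a, Nat.lt_succ_of_le (Nat.div_le_div_right (eL p.2).2.le)⟩,
      (p.1, ⟨p.2, rfl⟩)⟩) (fun _ _ => rfl)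
  refine hfam.mono ?_
  simp only [Finset.sum_const, Finset.card_univ, Fintype.card_fin, nsmul_eq_mul]
  have ha0 : (0 : ℝ) < a := by exact_mod_cast ha
  have hN : (N : ℝ) ≤ l / a + 1 := by
    push_cast [N]; gcongr; exact Nat.cast_div_le
  have hsq : ((a : ℝ) ^ 2) ^ (τ / 2) = (a : ℝ) ^ τ := by
    rw [← Real.rpow_natCast, ← Real.rpow_mul ha0.le]; congr 1; push_cast; ring
  rw [hsq]
  -- For l ≥ a one has l/a ≤ (l/a)^(τ/2), because τ/2 ≥ 1.
  have key : (l : ℝ) / a * (a : ℝ) ^ τ ≤ (a : ℝ) ^ τ + (a * l : ℝ) ^ (τ / 2) := by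
    rcases le_total (l : ℝ) a with hla | hla
    · have : (l : ℝ) / a ≤ 1 := (div_le_one ha0).2 hla
      have h5 : 0 ≤ (a : ℝ) ^ τ := by positivity
      have h6 : 0 ≤ (a * l : ℝ) ^ (τ / 2) := by positivity
      nlinarith
    · have h1 : 1 ≤ (l : ℝ) / a := (one_le_div ha0).2 hla
      have h7 : (a * l : ℝ) = (l / a) * a ^ 2 := by field_simp
      have h8 : (l : ℝ) / a ≤ (l / a : ℝ) ^ (τ / 2) := by
        simpa using Real.rpow_le_rpow_of_exponent_le h1 (show 1 ≤ τ / 2 by linarith)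
      rw [h7, Real.mul_rpow (by positivity) (by positivity), hsq]
      have h5 : 0 ≤ (a : ℝ) ^ τ := by positivity
      nlinarith
  calc (N : ℝ) * (b * a ^ τ) ≤ (l / a + 1) * (b * a ^ τ) := by gcongr
    _ = b * (l / a * a ^ τ) + b * a ^ τ := by ring
    _ ≤ b * (a ^ τ + (a * l : ℝ) ^ (τ / 2)) + b * a ^ τ := by gcongr
    _ = _ := by ring

/-! ### Irreducible representations: decomposition, Schur orthogonality, existence of complete
systems -/

theorem Representation.IsIrreducible.of_equiv {k G V W : Type*} [Field k] [Monoid G]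
    [AddCommGroup V] [Module k V] [AddCommGroup W] [Module k W] {ρ : Representation k G V}
    {σ : Representation k G W} (e : ρ.Equiv σ) (h : ρ.IsIrreducible) : σ.IsIrreducible := by
  rw [Representation.irreducible_iff_isSimpleModule_asModule] at h ⊢
  let f := Representation.IntertwiningMap.equivLinearMapAsModule ρ σ e.toIntertwiningMap
  have hf : Function.Bijective f := e.toLinearEquiv.bijective
  exact (LinearEquiv.isSimpleModule_iff (LinearEquiv.ofBijective f hf)).1 h

theorem toRep_apply {G : Type*} [Group G] {d : ℕ} (ρ : G →* Matrix (Fin d) (Fin d) ℂ) (g : G)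
    (v : Fin d → ℂ) : toRep ρ g v = (ρ g).mulVec v := rfl

theorem Matrix.blockDiagonal'_mulVec {o R : Type*} {m n : o → Type*} [Fintype o] [DecidableEq o]
    [∀ i, Fintype (n i)] [CommSemiring R] (M : ∀ i, Matrix (m i) (n i) R)
    (x : (Σ i, n i) → R) (p : Σ i, m i) :
    (Matrix.blockDiagonal' M).mulVec x p = (M p.1).mulVec (fun t => x ⟨p.1, t⟩) p.2 := by
  obtain ⟨k, t⟩ := p
  simp only [Matrix.mulVec, dotProduct, Fintype.sum_sigma]
  rw [Finset.sum_eq_single k]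
  · simp [Matrix.blockDiagonal'_apply_eq]
  · intro k' _ hk
    exact Finset.sum_eq_zero fun s _ => by
      rw [Matrix.blockDiagonal'_apply_ne _ _ _ hk.symm, zero_mul]
  · simp

/-- Write a representation on a finite-dimensional space in a basis. -/
theorem exists_toRep_equiv {G V : Type*} [Group G] [AddCommGroup V] [Module ℂ V]
    [FiniteDimensional ℂ V] (ρ : Representation ℂ G V) :
    ∃ σ : G →* Matrix (Fin (Module.finrank ℂ V)) (Fin (Module.finrank ℂ V)) ℂ,
      Nonempty (ρ.Equiv (toRep σ)) := by
  let b := Module.finBasis ℂ V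
  let T : Module.End ℂ V ≃ₐ[ℂ] _ := LinearMap.toMatrixAlgEquiv b
  refine ⟨(T : Module.End ℂ V →* _).comp ρ, ⟨Representation.Equiv.mk b.equivFun fun g => ?_⟩⟩
  ext1 v
  simp only [LinearMap.comp_apply, toRep_apply]
  exact (LinearMap.toMatrix_mulVec_repr b b (ρ g) v).symm

theorem GenDFT.IrrepSystem.exists_equiv {G V : Type*} [Group G] (R : IrrepSystem G) [AddCommGroup V]
    [Module ℂ V] [FiniteDimensional ℂ V] (ρ : Representation ℂ G V) (h : ρ.IsIrreducible) :
    ∃ i, Nonempty (ρ.Equiv (toRep (R.rep i))) := by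
  obtain ⟨σ, ⟨e⟩⟩ := exists_toRep_equiv ρ
  obtain ⟨i, ⟨e'⟩⟩ := R.complete _ σ (h.of_equiv e)
  exact ⟨i, ⟨e.trans e'⟩⟩

/-- A nonzero finite-dimensional representation contains an irreducible one. -/
theorem Representation.exists_irreducible_subrepresentation {G V : Type*} [Group G]
    [AddCommGroup V] [Module ℂ V] [FiniteDimensional ℂ V] [Nontrivial V]
    (ρ : Representation ℂ G V) :
    ∃ W : Subrepresentation ρ, W ≠ ⊥ ∧ W.toRepresentation.IsIrreducible := by
  classical
  have hex : ∃ n, ∃ W : Subrepresentation ρ, W ≠ ⊥ ∧ Module.finrank ℂ W.toSubmodule = n :=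
    ⟨_, ⊤, fun h => by
      have h1 : (⊤ : Submodule ℂ V) = ⊥ := congrArg Subrepresentation.toSubmodule h
      exact bot_ne_top h1.symm, rfl⟩
  -- A nonzero subrepresentation of least dimension is irreducible.
  obtain ⟨W, hW, hn⟩ := Nat.find_spec hex
  refine ⟨W, hW, ?_⟩
  have hne : W.toSubmodule ≠ ⊥ := fun h => hW (Subrepresentation.toSubmodule_injective h)
  have hnt : Nontrivial (Subrepresentation W.toRepresentation) := by
    refine ⟨⊥, ⊤, fun h => ?_⟩
    have h1 : (⊥ : Submodule ℂ W.toSubmodule) = ⊤ := congrArg Subrepresentation.toSubmodule h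
    have := (Submodule.nontrivial_iff_ne_bot).2 hne
    exact bot_ne_top h1
  refine { eq_bot_or_eq_top := fun X => ?_ }
  by_cases hX : X = ⊥
  · exact Or.inl hX
  right
  let Y : Subrepresentation ρ :=
    { toSubmodule := X.toSubmodule.map W.toSubmodule.subtype
      apply_mem_toSubmodule := by
        rintro g _ ⟨x, hx, rfl⟩
        exact ⟨W.toRepresentation g x, X.apply_mem_toSubmodule g hx, rfl⟩ }
  have hYb : Y ≠ ⊥ := by
    intro h
    apply hX
    apply Subrepresentation.toSubmodule_injective
    have h1 : X.toSubmodule.map W.toSubmodule.subtype = ⊥ :=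
      congrArg Subrepresentation.toSubmodule h
    exact (Submodule.map_injective_of_injective W.toSubmodule.injective_subtype)
      (h1.trans (Submodule.map_bot _).symm)
  have hle := Nat.find_min' hex ⟨Y, hYb, rfl⟩
  rw [← hn] at hle
  have hfr : Module.finrank ℂ Y.toSubmodule = Module.finrank ℂ X.toSubmodule :=
    Submodule.finrank_map_subtype_eq _ _
  apply Subrepresentation.toSubmodule_injective
  apply Submodule.eq_top_of_finrank_eq
  exact le_antisymm (Submodule.finrank_le _) (hfr ▸ hle)

/-- Complete reducibility, with the irreducible constituents taken from a given system. -/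
theorem GenDFT.IrrepSystem.exists_decomposition {G : Type*} [Group G] [Finite G] (R : IrrepSystem G)
    (n : ℕ) : ∀ {V : Type} [AddCommGroup V] [Module ℂ V] [FiniteDimensional ℂ V]
    (ρ : Representation ℂ G V), Module.finrank ℂ V = n →
    ∃ (X : Type) (_ : Fintype X) (_ : DecidableEq X) (i : X → R.index) (e : V ≃ₗ[ℂ] ((Σ k, Fin (R.dim (i k))) → ℂ)),
      ∀ g v, e (ρ g v) = (Matrix.blockDiagonal' fun k => R.rep (i k) g).mulVec (e v) := by
  induction n using Nat.strong_induction_on with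
  | _ n ih =>
  intro V _ _ _ ρ hn
  rcases subsingleton_or_nontrivial V with hV | hV
  · refine ⟨Empty, inferInstance, inferInstance, Empty.elim, LinearEquiv.ofSubsingleton _ _, fun g v => Subsingleton.elim _ _⟩
  obtain ⟨W, hW, hirr⟩ := ρ.exists_irreducible_subrepresentation
  -- Maschke's theorem: the lattice of subrepresentations is complemented. The induction continues
  -- on the complement.
  obtain ⟨W', hc⟩ := exists_isCompl W
  have hcs : IsCompl W.toSubmodule W'.toSubmodule := by
    refine IsCompl.of_eq ?_ ?_
    · exact congrArg Subrepresentation.toSubmodule hc.inf_eq_bot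
    · exact congrArg Subrepresentation.toSubmodule hc.sup_eq_top
  have hlt : Module.finrank ℂ W'.toSubmodule < n := by
    have h1 := Submodule.finrank_add_eq_of_isCompl hcs
    have h2 : 0 < Module.finrank ℂ W.toSubmodule :=
      Submodule.one_le_finrank_iff.2 fun h => hW (Subrepresentation.toSubmodule_injective h)
    omega
  obtain ⟨i, ⟨e₁⟩⟩ := R.exists_equiv _ hirr
  obtain ⟨X, _, _, j, e₂, he₂⟩ := ih _ hlt W'.toRepresentation rfl
  let P := Submodule.prodEquivOfIsCompl _ _ hcs
  let i' : Option X → R.index := fun k => k.elim i j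
  let F : ((Fin (R.dim i) → ℂ) × ((Σ k, Fin (R.dim (j k))) → ℂ)) ≃ₗ[ℂ]
      ((Σ k, Fin (R.dim (i' k))) → ℂ) :=
    { toFun := fun p q => match q with
        | ⟨none, t⟩ => p.1 t
        | ⟨some k, t⟩ => p.2 ⟨k, t⟩
      invFun := fun x => (fun t => x ⟨none, t⟩, fun q => x ⟨some q.1, q.2⟩)
      map_add' := fun p p' => by ext ⟨k | k, t⟩ <;> rfl
      map_smul' := fun c p => by ext ⟨k | k, t⟩ <;> rfl
      left_inv := fun p => rfl
      right_inv := fun x => by ext ⟨k | k, t⟩ <;> rfl }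
  refine ⟨Option X, inferInstance, inferInstance, i',
    P.symm.trans ((e₁.toLinearEquiv.prodCongr e₂).trans F), fun g v => ?_⟩
  obtain ⟨⟨w, w'⟩, rfl⟩ := P.surjective v
  have hP : ρ g (P (w, w')) = P (W.toRepresentation g w, W'.toRepresentation g w') := by
    simp [P, Submodule.coe_prodEquivOfIsCompl']
    rfl
  have h1 : e₁.toLinearEquiv (W.toRepresentation g w) =
      (R.rep i g).mulVec (e₁.toLinearEquiv w) :=
    congrArg (fun f => f w) (e₁.isIntertwining' g)
  simp only [hP, LinearEquiv.trans_apply, LinearEquiv.symm_apply_apply,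
    LinearEquiv.prodCongr_apply, h1, he₂]
  ext ⟨k, t⟩
  rw [Matrix.blockDiagonal'_mulVec]
  cases k with
  | none => rfl
  | some k => exact Matrix.blockDiagonal'_mulVec (fun k => R.rep (j k) g) (e₂ w') ⟨k, t⟩

/-- The form of complete reducibility used for restrictions to subgroups: `S` and `S'` are constants
of the circuit, and only the diagonal blocks vary with the group element. -/
theorem GenDFT.IrrepSystem.exists_matrix_decomposition {G : Type*} [Group G] [Finite G]
    (R : IrrepSystem G) {d : ℕ} (σ : G →* Matrix (Fin d) (Fin d) ℂ) :
    ∃ (X : Type) (_ : Fintype X) (_ : DecidableEq X) (i : X → R.index)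
      (S : Matrix (Fin d) (Σ k, Fin (R.dim (i k))) ℂ)
      (S' : Matrix (Σ k, Fin (R.dim (i k))) (Fin d) ℂ),
      Fintype.card (Σ k, Fin (R.dim (i k))) = d ∧
      ∀ g, σ g = S * (Matrix.blockDiagonal' fun k => R.rep (i k) g) * S' := by
  obtain ⟨X, _, _, i, e, he⟩ := R.exists_decomposition d (toRep σ) (by simp)
  refine ⟨X, inferInstance, inferInstance, i, LinearMap.toMatrix' e.symm.toLinearMap,
    LinearMap.toMatrix' e.toLinearMap, ?_, fun g => ?_⟩
  · have := e.finrank_eq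
    rw [Module.finrank_fin_fun, Module.finrank_fintype_fun_eq_card] at this
    exact this.symm
  · apply Matrix.toLin'.injective
    rw [Matrix.toLin'_mul, Matrix.toLin'_mul, Matrix.toLin'_toMatrix', Matrix.toLin'_toMatrix']
    apply LinearMap.ext
    intro w
    simp only [LinearMap.comp_apply, LinearEquiv.coe_coe, Matrix.toLin'_apply]
    rw [← he g w, LinearEquiv.symm_apply_apply, toRep_apply]

/-- Averaging any matrix over the group makes it commute with the actions, which is the input for
Schur's lemma. -/
theorem exists_averaged_intertwiningMap {G : Type*} [Group G] [Fintype G] {d e : ℕ}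
    (ρ : G →* Matrix (Fin d) (Fin d) ℂ) (σ : G →* Matrix (Fin e) (Fin e) ℂ)
    (E : Matrix (Fin d) (Fin e) ℂ) :
    ∃ f : (toRep σ).IntertwiningMap (toRep ρ),
      f.toLinearMap = Matrix.toLin' (∑ g, ρ g * E * σ g⁻¹) := by
  set F := ∑ g, ρ g * E * σ g⁻¹ with hFdef
  have hF : ∀ k, F * σ k = ρ k * F := by
    intro k
    rw [hFdef, Matrix.sum_mul, Matrix.mul_sum]
    refine Fintype.sum_equiv (Equiv.mulLeft k⁻¹) _ _ fun g => ?_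
    rw [Equiv.coe_mulLeft, Matrix.mul_assoc, ← map_mul, ← Matrix.mul_assoc, ← Matrix.mul_assoc,
      ← map_mul, mul_inv_cancel_left, mul_inv_rev, inv_inv]
  refine ⟨⟨Matrix.toLin' F, fun g => ?_⟩, rfl⟩
  show Matrix.toLin' F ∘ₗ Matrix.toLin' (σ g) = Matrix.toLin' (ρ g) ∘ₗ Matrix.toLin' F
  rw [← Matrix.toLin'_mul, ← Matrix.toLin'_mul, hF]

/-- Averaging a matrix unit produces exactly the sums in the orthogonality relations. -/
theorem sum_mul_single_mul_apply {G : Type*} [Group G] [Fintype G] {d e : ℕ}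
    (ρ : G →* Matrix (Fin d) (Fin d) ℂ) (σ : G →* Matrix (Fin e) (Fin e) ℂ)
    (a b : Fin d) (a' b' : Fin e) :
    (∑ g, ρ g * Matrix.single b a' (1 : ℂ) * σ g⁻¹) a b' = ∑ g, ρ g a b * σ g⁻¹ a' b' := by
  rw [Matrix.sum_apply]
  refine Finset.sum_congr rfl fun g _ => ?_
  rw [Matrix.mul_apply, Finset.sum_eq_single a']
  · simp
  · intro k _ hk
    rw [Matrix.mul_single_apply_of_ne _ _ _ _ _ hk, zero_mul]
  · simp

/-- Orthogonality of the matrix coefficients of inequivalent irreducible representations. -/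
theorem sum_coeff_mul_coeff_inv_of_ne {G : Type*} [Group G] [Fintype G] {d e : ℕ}
    (ρ : G →* Matrix (Fin d) (Fin d) ℂ) (σ : G →* Matrix (Fin e) (Fin e) ℂ)
    (hρ : (toRep ρ).IsIrreducible) (hσ : (toRep σ).IsIrreducible)
    (h : ¬ Nonempty ((toRep σ).Equiv (toRep ρ))) (a b : Fin d) (a' b' : Fin e) :
    ∑ g, ρ g a b * σ g⁻¹ a' b' = 0 := by
  obtain ⟨f, hf⟩ := exists_averaged_intertwiningMap ρ σ (Matrix.single b a' 1)
  have : IsEmpty ((toRep σ).Equiv (toRep ρ)) := not_nonempty_iff.1 h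
  have hf0 : f = 0 := Subsingleton.elim _ _
  rw [hf0, Representation.IntertwiningMap.zero_toLinearMap] at hf
  rw [← sum_mul_single_mul_apply, (map_eq_zero_iff _ Matrix.toLin'.injective).1 hf.symm]
  rfl

/-- By Schur's lemma the averaged matrix unit is a scalar, and its trace determines the scalar,
since conjugation preserves each summand's trace. -/
theorem sum_coeff_mul_coeff_inv_self {G : Type*} [Group G] [Fintype G] {d : ℕ}
    (ρ : G →* Matrix (Fin d) (Fin d) ℂ) (hρ : (toRep ρ).IsIrreducible) (a b a' b' : Fin d) :
    ∑ g, ρ g a b * ρ g⁻¹ a' b' = if a = b' ∧ b = a' then (Fintype.card G : ℂ) / d else 0 := by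
  obtain ⟨f, hf⟩ := exists_averaged_intertwiningMap ρ ρ (Matrix.single b a' 1)
  obtain ⟨c, rfl⟩ :=
    (Representation.IsIrreducible.algebraMap_intertwiningMap_bijective_of_isAlgClosed
      (ρ := toRep ρ)).2 f
  have hc : ∑ g, ρ g * Matrix.single b a' 1 * ρ g⁻¹ = c • (1 : Matrix (Fin d) (Fin d) ℂ) := by
    apply Matrix.toLin'.injective
    rw [← hf, map_smul, Matrix.toLin'_one]
    rfl
  have htr := congrArg Matrix.trace hc
  rw [Matrix.trace_sum, Matrix.trace_smul, Matrix.trace_one] at htr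
  have h1 : ∀ g, (ρ g * Matrix.single b a' 1 * ρ g⁻¹).trace = if b = a' then 1 else 0 := by
    intro g
    rw [Matrix.mul_assoc, Matrix.trace_mul_comm, Matrix.mul_assoc, ← map_mul, inv_mul_cancel,
      map_one, Matrix.mul_one]
    split_ifs with hba
    · rw [hba, Matrix.trace_single_eq_same]
    · exact Matrix.trace_single_eq_of_ne _ _ _ hba
  simp only [h1, Fintype.card_fin, smul_eq_mul, Finset.sum_const, Finset.card_univ] at htr
  have hd : (d : ℂ) ≠ 0 := by
    have : 0 < d := Fin.pos a
    exact_mod_cast this.ne'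
  rw [← sum_mul_single_mul_apply, hc, Matrix.smul_apply, Matrix.one_apply]
  have hcv : c = (if b = a' then (Fintype.card G : ℂ) / d else 0) := by
    rw [eq_div_of_mul_eq hd htr.symm]
    split_ifs <;> simp
  rw [hcv]
  by_cases h1 : a = b' <;> by_cases h2 : b = a' <;> simp [h1, h2]

/-- The matrix coefficients of pairwise inequivalent irreducible representations are linearly
independent. -/
theorem linearIndependent_coeff {G : Type*} [Group G] [Fintype G] {A : Type*} {d : A → ℕ}
    (ρ : ∀ i, G →* Matrix (Fin (d i)) (Fin (d i)) ℂ) (hirr : ∀ i, (toRep (ρ i)).IsIrreducible)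
    (hne : ∀ i j, Nonempty ((toRep (ρ i)).Equiv (toRep (ρ j))) → i = j) :
    LinearIndependent ℂ fun (p : Σ i, Fin (d i) × Fin (d i)) (g : G) => ρ p.1 g p.2.1 p.2.2 := by
  classical
  rw [linearIndependent_iff']
  intro s c hc q hq
  -- Pair the linear relation with the coefficient dual to `q`; orthogonality isolates `c q`.
  have h1 : ∑ g, (∑ p ∈ s, c p * ρ p.1 g p.2.1 p.2.2) * ρ q.1 g⁻¹ q.2.2 q.2.1 = 0 := by
    refine Finset.sum_eq_zero fun g _ => ?_
    have := congrFun hc g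
    simp only [Finset.sum_apply, Pi.smul_apply, smul_eq_mul, Pi.zero_apply] at this
    rw [this, zero_mul]
  simp only [Finset.sum_mul] at h1
  rw [Finset.sum_comm, Finset.sum_eq_single_of_mem q hq] at h1
  · simp only [mul_assoc] at h1
    rw [← Finset.mul_sum, sum_coeff_mul_coeff_inv_self _ (hirr q.1), if_pos ⟨rfl, rfl⟩] at h1
    refine (mul_eq_zero.1 h1).resolve_right (div_ne_zero ?_ ?_)
    · exact_mod_cast Fintype.card_ne_zero
    · exact_mod_cast (Fin.pos q.2.1).ne'
  · intro p _ hpq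
    simp only [mul_assoc]
    rw [← Finset.mul_sum]
    obtain ⟨i, a, b⟩ := p
    obtain ⟨j, a', b'⟩ := q
    by_cases hij : i = j
    · subst hij
      rw [sum_coeff_mul_coeff_inv_self _ (hirr i), if_neg, mul_zero]
      rintro ⟨rfl, rfl⟩
      exact hpq rfl
    · rw [sum_coeff_mul_coeff_inv_of_ne _ _ (hirr i) (hirr j), mul_zero]
      exact fun h => hij (hne _ _ h).symm

attribute [instance] GenDFT.IrrepSystem.fintype

/-- The matrix coefficients are independent functions on `G`, a space of dimension |G|. Only this
inequality is needed, not equality. -/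
theorem GenDFT.IrrepSystem.sum_sq_le {G : Type*} [Group G] [Fintype G] (R : IrrepSystem G) :
    ∑ i, R.dim i ^ 2 ≤ Fintype.card G := by
  have := (linearIndependent_coeff R.rep R.irreducible R.inequivalent).fintype_card_le_finrank
  rw [Module.finrank_fintype_fun_eq_card, Fintype.card_sigma] at this
  simpa [sq] using this

theorem pos_of_toRep_isIrreducible {G : Type*} [Group G] {d : ℕ}
    {ρ : G →* Matrix (Fin d) (Fin d) ℂ} (h : (toRep ρ).IsIrreducible) : 0 < d := by
  rcases Nat.eq_zero_or_pos d with rfl | hd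
  · have := h.toNontrivial
    obtain ⟨x, y, hxy⟩ := exists_pair_ne (Subrepresentation (toRep ρ))
    exact absurd (Subrepresentation.toSubmodule_injective (Subsingleton.elim _ _)) hxy
  · exact hd

theorem GenDFT.IrrepSystem.nonempty (G : Type*) [Group G] [Finite G] :
    Nonempty (IrrepSystem G) := by
  classical
  have := Fintype.ofFinite G
  let Irr := {p : Σ d, G →* Matrix (Fin d) (Fin d) ℂ // (toRep p.2).IsIrreducible}
  let S : Setoid Irr :=
    { r := fun p q => Nonempty ((toRep p.1.2).Equiv (toRep q.1.2))
      iseqv := ⟨fun _ => ⟨.refl _⟩, fun ⟨e⟩ => ⟨e.symm⟩, fun ⟨e⟩ ⟨f⟩ => ⟨e.trans f⟩⟩ }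
  let A := Quotient S
  have hne : ∀ i j : A, Nonempty ((toRep i.out.1.2).Equiv (toRep j.out.1.2)) → i = j :=
    fun i j h => Quotient.out_equiv_out.1 h
  -- Each class contributes at least one coefficient function, and these are independent in a
  -- finite-dimensional space.
  have hfin : Finite A := by
    have h1 := (linearIndependent_coeff (fun i : A => i.out.1.2) (fun i => i.out.2) hne).finite
    refine Finite.of_injective (β := Σ i : A, Fin i.out.1.1 × Fin i.out.1.1)
      (fun i => ⟨i, ⟨0, pos_of_toRep_isIrreducible i.out.2⟩,
        ⟨0, pos_of_toRep_isIrreducible i.out.2⟩⟩) fun i j h => congrArg Sigma.fst h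
  -- The index type of a system must lie in `Type`, whatever the universe of `G`.
  let e := Finite.equivFin A
  exact ⟨{
    index := Fin (Nat.card A)
    dim := fun k => (e.symm k).out.1.1
    rep := fun k => (e.symm k).out.1.2
    irreducible := fun k => (e.symm k).out.2
    inequivalent := fun i j h => e.symm.injective (hne _ _ h)
    complete := fun d σ h => by
      refine ⟨e (Quotient.mk S ⟨⟨d, σ⟩, h⟩), ?_⟩
      rw [e.symm_apply_apply]
      exact Setoid.symm (Quotient.mk_out (s := S) ⟨⟨d, σ⟩, h⟩) }⟩

/-! ### Reduction of a DFT along factorizations of the group -/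

/-- Every generalized DFT of `G` can be computed with at most `r` operations. -/
def FastDFT (G : Type*) [Group G] [Fintype G] (r : ℝ) : Prop :=
  ∀ R : IrrepSystem G, CostLE (dft R) r

theorem FastDFT.mono {G : Type*} [Group G] [Fintype G] {r t : ℝ} (h : FastDFT G r) (hrt : r ≤ t) :
    FastDFT G t := fun R => (h R).mono hrt

theorem FastDFT.nonneg {G : Type*} [Group G] [Fintype G] {r : ℝ} (h : FastDFT G r) : 0 ≤ r :=
  (h (IrrepSystem.nonempty G).some).nonneg

theorem dft_apply {G : Type*} [Group G] [Fintype G] (R : IrrepSystem G) (c : G → ℂ)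
    (p : Σ i : R.index, Fin (R.dim i) × Fin (R.dim i)) :
    dft R c p = ∑ g, c g * R.rep p.1 g p.2.1 p.2.2 := by
  simp [dft, Matrix.sum_apply]

/-- Write x^α = x · x^(α-1) and bound the second factor by its value at the total. It lets many
small matrix products be charged to one power of the group order. -/
theorem Real.sum_rpow_le_rpow_sum {A : Type*} (s : Finset A) (f : A → ℝ) (hf : ∀ a ∈ s, 0 ≤ f a)
    {α : ℝ} (hα : 1 ≤ α) : ∑ a ∈ s, f a ^ α ≤ (∑ a ∈ s, f a) ^ α := by
  have hS : 0 ≤ ∑ a ∈ s, f a := Finset.sum_nonneg hf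
  have key : ∀ x : ℝ, 0 ≤ x → x ^ α = x * x ^ (α - 1) := by
    intro x hx
    rcases hx.eq_or_lt with rfl | hx
    · rw [Real.zero_rpow (by linarith), zero_mul]
    · rw [← Real.rpow_one_add' hx.le (by linarith)]; congr 1; ring
  rw [key _ hS, Finset.sum_mul]
  refine Finset.sum_le_sum fun a ha => ?_
  rw [key _ (hf a ha)]
  have := hf a ha
  have h2 : f a ≤ ∑ a ∈ s, f a := Finset.single_le_sum hf ha
  gcongr

/-- Two one-sided products by constant d × d matrices, at 3b each. -/
theorem MatMulBound.const_mul_const {b τ : ℝ} (h : MatMulBound b τ) {I J : Type*} [Fintype I]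
    [Fintype J] {d : ℕ} (hI : Fintype.card I = d) (hJ : Fintype.card J = d)
    (P : Fin d → I → ℂ) (Q : J → Fin d → ℂ) :
    CostLE (fun (x : I × J → ℂ) (p : Fin d × Fin d) => ∑ i, P p.1 i * ∑ j, x (i, j) * Q j p.2)
      (6 * b * ((d : ℝ) ^ 2) ^ (τ / 2)) := by
  have h1 := h.mul_const hI.le hJ.le Q
  have h2 := h.mul_const (I := Fin d) (J := I) (L := Fin d) (a := d) (by simp) hI.le
    (fun i p => P p i)
  have h3 := ((h2.inp fun p : Fin d × I => (p.2, p.1)).comp h1).out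
    fun p : Fin d × Fin d => (p.2, p.1)
  refine CostLE.mono (by simpa only [mul_comm] using h3) (le_of_eq ?_)
  simp only [Fintype.card_fin]
  ring_nf

/-- Multiplication of variable blocks by all the blocks of constant block matrices `M r`. -/
theorem MatMulBound.block_products {b τ : ℝ} (h : MatMulBound b τ) {I J B : Type*} [Fintype I]
    [Fintype J] [Fintype B] (dI : I → ℕ) (dJ : J → ℕ) {X Y : B → Type*} [∀ r, Fintype (X r)]
    [∀ r, Fintype (Y r)] (i : ∀ r, X r → I) (j : ∀ r, Y r → J)
    (M : ∀ r, (Σ k, Fin (dI (i r k))) → (Σ k, Fin (dJ (j r k))) → ℂ) {N₁ N₂ : ℕ}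
    (h₁ : (∑ k, dI k ^ 2) * (∑ k, dJ k ^ 2) ≤ N₁)
    (h₂ : ∑ r, Fintype.card (Σ k, Fin (dI (i r k))) * Fintype.card (Σ k, Fin (dJ (j r k))) ≤ N₂) :
    CostLE (fun (e : (Σ k, Fin (dI k) × Fin (dI k)) × (Σ k, Fin (dJ k) × Fin (dJ k)) → ℂ)
        (p : Σ r, (Σ k, Fin (dI (i r k))) × (Σ k, Fin (dJ (j r k)))) =>
        ∑ q : Fin (dI (i p.1 p.2.1.1)) × Fin (dJ (j p.1 p.2.2.1)),
          e (⟨i p.1 p.2.1.1, (p.2.1.2, q.1)⟩, ⟨j p.1 p.2.2.1, (q.2, p.2.2.2)⟩) *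
            M p.1 ⟨p.2.1.1, q.1⟩ ⟨p.2.2.1, q.2⟩)
      (2 * b * (N₁ : ℝ) ^ (τ / 2) + b * (N₂ : ℝ) ^ (τ / 2)) := by
  classical
  have hb := h.nonneg
  have hα : 1 ≤ τ / 2 := by linarith [h.two_le]
  -- A pair of blocks of some representation `r` is labelled by its pair of constituents. All
  -- occurrences of one pair share the same variable matrix, a Kronecker product of size `dI * dJ`,
  -- and each contributes one column of constants.
  let f : (Σ r, X r × Y r) → I × J := fun l => (i l.1 l.2.1, j l.1 l.2.2)
  let M' : ∀ c : I × J, Fin (dI c.1) × Fin (dJ c.2) → {l // f l = c} → ℂ := fun c q l =>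
    M l.1.1 ⟨l.1.2.1, Fin.cast (congrArg (fun c => dI c.1) l.2.symm) q.1⟩
      ⟨l.1.2.2, Fin.cast (congrArg (fun c => dJ c.2) l.2.symm) q.2⟩
  have hc := fun c : I × J =>
    (h.mul_const (I := Fin (dI c.1) × Fin (dJ c.2)) (a := dI c.1 * dJ c.2) (by simp) (by simp)
      (M' c)).inp fun p => ((⟨c.1, (p.1.1, p.2.1)⟩, ⟨c.2, (p.2.2, p.1.2)⟩) :
        (Σ k, Fin (dI k) × Fin (dI k)) × (Σ k, Fin (dJ k) × Fin (dJ k)))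
  refine (CostLE.family hc (fun p : (Σ r, (Σ k, Fin (dI (i r k))) × (Σ k, Fin (dJ (j r k)))) =>
    ⟨(i p.1 p.2.1.1, j p.1 p.2.2.1),
    ((p.2.1.2, p.2.2.2), ⟨⟨p.1, (p.2.1.1, p.2.2.1)⟩, rfl⟩)⟩) fun _ _ => rfl).mono ?_
  rw [Finset.sum_add_distrib, ← Finset.mul_sum, ← Finset.mul_sum]
  gcongr
  · refine (Real.sum_rpow_le_rpow_sum _ _ (fun _ _ => by positivity) hα).trans ?_
    gcongr
    have e1 : (∑ c : I × J, (((dI c.1 * dJ c.2 : ℕ) : ℝ)) ^ 2) =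
        (((∑ i, dI i ^ 2) * (∑ j, dJ j ^ 2) : ℕ) : ℝ) := by
      push_cast
      rw [Finset.sum_mul_sum, Fintype.sum_prod_type]
      exact Finset.sum_congr rfl fun _ _ => Finset.sum_congr rfl fun _ _ => by ring
    rw [e1]
    exact_mod_cast h₁
  · refine (Real.sum_rpow_le_rpow_sum _ _ (fun _ _ => by positivity) hα).trans ?_
    gcongr
    -- Matrix size times number of columns, summed over all pairs, counts the entries of all the
    -- constant matrices `M r`.
    have e1 : ∑ c : I × J, dI c.1 * dJ c.2 * Fintype.card {l // f l = c} =
        ∑ l, dI (f l).1 * dJ (f l).2 := by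
      rw [← Finset.sum_fiberwise' Finset.univ f fun c => dI c.1 * dJ c.2]
      refine Finset.sum_congr rfl fun c _ => ?_
      rw [Finset.sum_const, Fintype.card_subtype, smul_eq_mul, mul_comm]
    have e2 : ∑ l, dI (f l).1 * dJ (f l).2 =
        ∑ r, Fintype.card (Σ k, Fin (dI (i r k))) * Fintype.card (Σ k, Fin (dJ (j r k))) := by
      rw [Fintype.sum_sigma]
      refine Finset.sum_congr rfl fun r _ => ?_
      simp only [Fintype.card_sigma, Fintype.card_fin]
      rw [Fintype.sum_prod_type, Finset.sum_mul_sum]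
    exact_mod_cast (e1.trans e2).trans_le h₂

/-- Multiplication of variable matrices by constant ones on both sides. -/
theorem MatMulBound.change_basis {b τ : ℝ} (h : MatMulBound b τ) {B : Type*} [Fintype B]
    (d : B → ℕ) {X Y : B → Type*} [∀ r, Fintype (X r)] [∀ r, Fintype (Y r)]
    (hX : ∀ r, Fintype.card (X r) = d r) (hY : ∀ r, Fintype.card (Y r) = d r)
    (P : ∀ r, Fin (d r) → X r → ℂ) (Q : ∀ r, Y r → Fin (d r) → ℂ) {N : ℕ}
    (hN : ∑ r, d r ^ 2 ≤ N) :
    CostLE (fun (v : (Σ r, X r × Y r) → ℂ) (p : Σ r, Fin (d r) × Fin (d r)) =>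
        ∑ q, P p.1 p.2.1 q * ∑ q', v ⟨p.1, (q, q')⟩ * Q p.1 q' p.2.2)
      (6 * b * (N : ℝ) ^ (τ / 2)) := by
  have hb := h.nonneg
  have hα : 1 ≤ τ / 2 := by linarith [h.two_le]
  refine (CostLE.family
    (fun r => (h.const_mul_const (hX r) (hY r) (P r) (Q r)).inp fun p => (⟨r, p⟩ : Σ r, X r × Y r))
    (fun p : (Σ r, Fin (d r) × Fin (d r)) => ⟨p.1, p.2⟩) fun _ _ => rfl).mono ?_
  rw [← Finset.mul_sum]
  gcongr
  refine (Real.sum_rpow_le_rpow_sum _ _ (fun _ _ => by positivity) hα).trans ?_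
  gcongr
  exact_mod_cast hN

/-- The DFT of `H × K` on functions that are supported on `A × K`. -/
theorem FastDFT.prod_transform {H K : Type*} [Group H] [Fintype H] [Group K] [Fintype K]
    {tH tK : ℝ} (hH : FastDFT H tH) (hK : FastDFT K tK) (RH : IrrepSystem H) (RK : IrrepSystem K)
    (A : Finset H) :
    CostLE (fun (z : A × K → ℂ) (p : (Σ i : RH.index, Fin (RH.dim i) × Fin (RH.dim i)) ×
        (Σ j : RK.index, Fin (RK.dim j) × Fin (RK.dim j))) =>
        ∑ a : A, (∑ k, z (a, k) * RK.rep p.2.1 k p.2.2.1 p.2.2.2) * RH.rep p.1.1 a p.1.2.1 p.1.2.2)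
      (A.card * tK + Fintype.card K * tH) := by
  classical
  let IK := Σ j : RK.index, Fin (RK.dim j) × Fin (RK.dim j)
  let IH := Σ i : RH.index, Fin (RH.dim i) × Fin (RH.dim i)
  let s₁ : (A × K → ℂ) → (A × IK → ℂ) := fun z p => dft RK (fun k => z (p.1, k)) p.2
  have c₁ : CostLE s₁ (A.card * tK) := by
    have := CostLE.family (F := s₁) (fun a : A => (hK RK).inp fun k => (a, k))
      (fun p => ⟨p.1, p.2⟩) fun _ _ => rfl
    simpa using this
  let s₂ : (A × IK → ℂ) → (IH × IK → ℂ) := fun v p =>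
    dft RH (fun h => if hA : h ∈ A then v (⟨h, hA⟩, p.2) else 0) p.1
  have c₂ : CostLE s₂ (Fintype.card K * tH) := by
    have h1 : ∀ q : IK, CostLE (fun (v : A × IK → ℂ) =>
        dft RH (fun h => if hA : h ∈ A then v (⟨h, hA⟩, q) else 0)) tH := by
      intro q
      have h2 := (hH RH).comp (CostLE.select (ι := A × IK)
        fun h => if hA : h ∈ A then Sum.inl (⟨h, hA⟩, q) else Sum.inr 0)
      rw [zero_add] at h2
      convert h2 using 4 with v h
      split_ifs <;> rfl
    have := CostLE.family (F := s₂) h1 (fun p => ⟨p.2, p.1⟩) fun _ _ => rfl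
    refine this.mono ?_
    rw [Finset.sum_const, nsmul_eq_mul, Finset.card_univ]
    -- The transform over `H` is repeated once for each coefficient of `K`, hence at most |K| times.
    have hc : Fintype.card IK ≤ Fintype.card K := by
      have := RK.sum_sq_le
      simpa [IK, Fintype.card_sigma, sq] using this
    have := hH.nonneg
    gcongr
  convert c₂.comp c₁ using 3 with z p
  simp only [s₂, s₁, dft_apply]
  rw [← Finset.sum_subset (Finset.subset_univ A) fun h _ hA => by rw [dif_neg hA, zero_mul],
    ← Finset.sum_coe_sort A]
  exact Finset.sum_congr rfl fun a _ => by rw [dif_pos a.2]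

theorem Matrix.sum_mul_block_mul {X Y : Type*} [Fintype X] [Fintype Y] [DecidableEq X]
    [DecidableEq Y] {m : X → ℕ} {n : Y → ℕ} (D : ∀ k, Matrix (Fin (m k)) (Fin (m k)) ℂ)
    (E : ∀ k, Matrix (Fin (n k)) (Fin (n k)) ℂ)
    (M : Matrix (Σ k, Fin (m k)) (Σ k, Fin (n k)) ℂ) (p : Σ k, Fin (m k)) (q : Σ k, Fin (n k)) :
    (Matrix.blockDiagonal' D * M * Matrix.blockDiagonal' E) p q =
      ∑ r : Fin (m p.1) × Fin (n q.1), D p.1 p.2 r.1 * E q.1 r.2 q.2 * M ⟨p.1, r.1⟩ ⟨q.1, r.2⟩ := by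
  obtain ⟨k, u⟩ := p
  obtain ⟨l, v⟩ := q
  have h1 : ∀ x, (Matrix.blockDiagonal' D * M) ⟨k, u⟩ x = ∑ s, D k u s * M ⟨k, s⟩ x := by
    intro x
    rw [Matrix.mul_apply, Fintype.sum_sigma, Finset.sum_eq_single k]
    · simp [Matrix.blockDiagonal'_apply_eq]
    · intro k' _ hk
      exact Finset.sum_eq_zero fun s _ => by
        rw [Matrix.blockDiagonal'_apply_ne _ _ _ hk.symm, zero_mul]
    · simp
  rw [Matrix.mul_apply, Fintype.sum_sigma, Finset.sum_eq_single l]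
  · simp only [h1, Matrix.blockDiagonal'_apply_eq, Finset.sum_mul]
    rw [Finset.sum_comm, Fintype.sum_prod_type]
    exact Finset.sum_congr rfl fun _ _ => Finset.sum_congr rfl fun _ _ => by ring
  · intro l' _ hl
    exact Finset.sum_eq_zero fun s _ => by
      rw [Matrix.blockDiagonal'_apply_ne _ _ _ hl, mul_zero]
  · simp

/-- The DFT of a function supported on `x A y K`, through the DFTs of `H ⊇ A` and of `K`. -/
theorem dft_double_coset_cost {G H K : Type*} [Group G] [Fintype G] [Group H] [Fintype H] [Group K]
    [Fintype K] (φ : H →* G) (ψ : K →* G) (A : Finset H) (x y : G) {tH tK b τ : ℝ}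
    (hM : MatMulBound b τ) (hH : FastDFT H tH) (hK : FastDFT K tK) (R : IrrepSystem G) :
    CostLE (fun (z : A × K → ℂ) (p : Σ i : R.index, Fin (R.dim i) × Fin (R.dim i)) =>
        ∑ a : A, ∑ k, z (a, k) * R.rep p.1 (x * φ a * y * ψ k) p.2.1 p.2.2)
      (A.card * tK + Fintype.card K * tH +
        2 * b * (Fintype.card H * Fintype.card K : ℝ) ^ (τ / 2) +
        7 * b * (Fintype.card G : ℝ) ^ (τ / 2)) := by
  obtain ⟨RH⟩ := IrrepSystem.nonempty H
  obtain ⟨RK⟩ := IrrepSystem.nonempty K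
  choose X _ _ i S S' hSc hS using fun r => RH.exists_matrix_decomposition ((R.rep r).comp φ)
  choose Y _ _ j T T' hTc hT using fun r => RK.exists_matrix_decomposition ((R.rep r).comp ψ)
  have c₁ := hH.prod_transform hK RH RK A
  -- The middle element `y` enters only through the constant matrices between the two block diagonal
  -- factors.
  have c₂ := hM.block_products RH.dim RK.dim i j (fun r => S' r * R.rep r y * T r)
    (N₁ := Fintype.card H * Fintype.card K) (N₂ := Fintype.card G)
    (Nat.mul_le_mul RH.sum_sq_le RK.sum_sq_le)
    (by simp only [hSc, hTc, ← sq]; exact R.sum_sq_le)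
  -- Left translation by `x` is absorbed in the change of basis. This step accounts for 6b of the
  -- final 7b, and the block products for the remaining b.
  have c₃ := hM.change_basis R.dim hSc hTc (fun r => R.rep r x * S r) T' R.sum_sq_le
  have htot := (c₃.comp (c₂.comp c₁)).mono (t := A.card * tK + Fintype.card K * tH +
        2 * b * (Fintype.card H * Fintype.card K : ℝ) ^ (τ / 2) +
        7 * b * (Fintype.card G : ℝ) ^ (τ / 2)) (by push_cast; linarith)
  convert htot using 3 with z p
  obtain ⟨r, u, v⟩ := p
  have h1 : ∀ (a : A) (k : K), R.rep r (x * φ a * y * ψ k) = (R.rep r x * S r) *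
      (((Matrix.blockDiagonal' fun κ => RH.rep (i r κ) a) * (S' r * R.rep r y * T r) *
        (Matrix.blockDiagonal' fun κ => RK.rep (j r κ) k)) * T' r) := by
    intro a k
    have e1 : R.rep r (φ a) = _ := hS r a
    have e2 : R.rep r (ψ k) = _ := hT r k
    rw [map_mul, map_mul, map_mul, e1, e2]
    simp only [Matrix.mul_assoc]
  have h2 : ∑ a : A, ∑ k, z (a, k) • R.rep r (x * φ a * y * ψ k) = (R.rep r x * S r) *
      ((∑ a : A, ∑ k, z (a, k) •
        ((Matrix.blockDiagonal' fun κ => RH.rep (i r κ) a) * (S' r * R.rep r y * T r) *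
        (Matrix.blockDiagonal' fun κ => RK.rep (j r κ) k))) * T' r) := by
    simp only [h1, Matrix.sum_mul, Matrix.mul_sum, Matrix.smul_mul, Matrix.mul_smul]
  have h3 := congrFun (congrFun h2 u) v
  simp only [Matrix.sum_apply, Matrix.smul_apply, smul_eq_mul] at h3
  rw [h3, Matrix.mul_apply]
  refine Finset.sum_congr rfl fun q _ => ?_
  rw [Matrix.mul_apply]
  congr 1
  refine Finset.sum_congr rfl fun q' _ => ?_
  congr 1
  simp only [Matrix.sum_apply, Matrix.smul_apply, Matrix.sum_mul_block_mul, smul_eq_mul,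
    Finset.sum_mul, Finset.mul_sum]
  conv_rhs => rw [Finset.sum_comm]
  refine Finset.sum_congr rfl fun a _ => ?_
  conv_rhs => rw [Finset.sum_comm]
  refine Finset.sum_congr rfl fun k _ => Finset.sum_congr rfl fun q _ => ?_
  ring

/-- If `G` is covered by the sets `x A y K`, with `A` a part of a group `H`, then the DFT of `G`
reduces to the DFTs of `H` and of `K`. -/
theorem FastDFT.of_cover {G H K : Type*} [Group G] [Fintype G] [Group H] [Fintype H] [Group K]
    [Fintype K] (φ : H →* G) (ψ : K →* G) (A : Finset H) {W : Type*} [Fintype W] (x y : W → G)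
    (hcover : ∀ g, ∃ w, ∃ a ∈ A, ∃ k, x w * φ a * y w * ψ k = g) {tH tK b τ : ℝ}
    (hM : MatMulBound b τ) (hH : FastDFT H tH) (hK : FastDFT K tK) :
    FastDFT G (Fintype.card W * (A.card * tK + Fintype.card K * tH +
        2 * b * (Fintype.card H * Fintype.card K : ℝ) ^ (τ / 2) +
        (7 * b + 1) * (Fintype.card G : ℝ) ^ (τ / 2))) := by
  classical
  intro R
  -- The cover may overlap, so one factorization of each `g` is fixed, and `c` feeds 0 to every
  -- other one.
  choose w a ha k hwak using hcover
  let c : W → A × K → G ⊕ ℂ := fun v p =>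
    if v = w (x v * φ p.1 * y v * ψ p.2) ∧ p.1.1 = a (x v * φ p.1 * y v * ψ p.2) ∧
      p.2 = k (x v * φ p.1 * y v * ψ p.2) then Sum.inl (x v * φ p.1 * y v * ψ p.2) else Sum.inr 0
  have h1 := CostLE.sum (Finset.univ : Finset W) fun v _ =>
    (dft_double_coset_cost φ ψ A (x v) (y v) hM hH hK R).comp (CostLE.select (c v))
  refine h1.congr (fun z p => ?_) ?_
  · have h2 : ∀ v (q : A × K), Sum.elim z id (c v q) *
        R.rep p.1 (x v * φ q.1 * y v * ψ q.2) p.2.1 p.2.2 =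
        ∑ g, if (w g, (⟨a g, ha g⟩, k g)) = (v, q) then z g * R.rep p.1 g p.2.1 p.2.2 else 0 := by
      intro v q
      have h4 : ∀ g, (w g, ((⟨a g, ha g⟩, k g) : A × K)) = (v, q) →
          g = x v * φ q.1 * y v * ψ q.2 := by
        rintro g hg
        obtain ⟨rfl, h5⟩ := Prod.mk.inj hg
        obtain ⟨h6, h7⟩ := Prod.ext_iff.1 h5
        rw [← h6, ← h7]
        exact (hwak g).symm
      by_cases hq : (w (x v * φ q.1 * y v * ψ q.2), ((⟨a (x v * φ q.1 * y v * ψ q.2), ha _⟩,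
          k (x v * φ q.1 * y v * ψ q.2)) : A × K)) = (v, q)
      · rw [Finset.sum_eq_single (x v * φ q.1 * y v * ψ q.2), if_pos hq]
        · have : c v q = Sum.inl (x v * φ q.1 * y v * ψ q.2) := by
            obtain ⟨h5, h6⟩ := Prod.mk.inj hq
            obtain ⟨h7, h8⟩ := Prod.ext_iff.1 h6
            exact if_pos ⟨h5.symm, (congrArg Subtype.val h7).symm, h8.symm⟩
          rw [this]
          rfl
        · intro g _ hg
          exact if_neg fun h => hg (h4 g h)
        · simp
      · rw [Finset.sum_eq_zero]
        · have : c v q = Sum.inr 0 := if_neg fun h => hq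
            (Prod.ext h.1.symm (Prod.ext (Subtype.ext h.2.1.symm) h.2.2.symm))
          rw [this]
          simp
        · intro g _
          exact if_neg fun h => hq (h4 g h ▸ h)
    rw [dft_apply]
    have h3 : ∀ v, ∑ a' : A, ∑ k', Sum.elim z id (c v (a', k')) *
        R.rep p.1 (x v * φ a' * y v * ψ k') p.2.1 p.2.2 = ∑ q : A × K, ∑ g,
          if (w g, (⟨a g, ha g⟩, k g)) = (v, q) then z g * R.rep p.1 g p.2.1 p.2.2 else 0 := by
      intro v
      rw [Fintype.sum_prod_type]
      exact Finset.sum_congr rfl fun a' _ => Finset.sum_congr rfl fun k' _ => h2 v (a', k')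
    simp only [h3]
    rw [← Fintype.sum_prod_type' fun v q => ∑ g, if (w g, ((⟨a g, ha g⟩, k g) : A × K)) = (v, q)
      then z g * R.rep p.1 g p.2.1 p.2.2 else 0, Finset.sum_comm]
    exact Finset.sum_congr rfl fun g _ => by simp only [Prod.mk.eta, Finset.sum_ite_eq,
      Finset.mem_univ, if_true]
  · rw [Finset.sum_const, nsmul_eq_mul, Finset.card_univ]
    have h4 : (Fintype.card (Σ i : R.index, Fin (R.dim i) × Fin (R.dim i)) : ℝ) ≤
        (Fintype.card G : ℝ) ^ (τ / 2) := by
      have h5 : Fintype.card (Σ i : R.index, Fin (R.dim i) × Fin (R.dim i)) ≤ Fintype.card G := by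
        have := R.sum_sq_le
        simpa [Fintype.card_sigma, sq] using this
      have h6 : (1 : ℝ) ≤ Fintype.card G := by exact_mod_cast Fintype.card_pos
      calc (Fintype.card (Σ i : R.index, Fin (R.dim i) × Fin (R.dim i)) : ℝ)
          ≤ Fintype.card G := by exact_mod_cast h5
        _ ≤ _ := by
          simpa using Real.rpow_le_rpow_of_exponent_le h6
            (show 1 ≤ τ / 2 by linarith [hM.two_le])
    refine mul_le_mul_of_nonneg_left ?_ (Nat.cast_nonneg _)
    linarith

/-- Because n ≤ n^α and |A||K| ≤ |G|, the constant of `K` passes with factor one inside the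
parentheses, and only that of `H` is multiplied by M^α. With a single cell, an induction that puts
the previous stage in the role of `K` therefore adds a fixed amount at each stage instead of
multiplying. -/
theorem FastDFT.of_cover_of_card_le {G H K : Type*} [Group G] [Fintype G] [Group H] [Fintype H]
    [Group K] [Fintype K] (φ : H →* G) (ψ : K →* G) (A : Finset H) {W : Type*} [Fintype W]
    (x y : W → G) (hcover : ∀ g, ∃ w, ∃ a ∈ A, ∃ k, x w * φ a * y w * ψ k = g)
    {cH cK b α M : ℝ} (hM : MatMulBound b (2 * α))
    (hH : FastDFT H (cH * (Fintype.card H : ℝ) ^ α))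
    (hK : FastDFT K (cK * (Fintype.card K : ℝ) ^ α)) (hcH : 0 ≤ cH) (hcK : 0 ≤ cK)
    (hAK : A.card * Fintype.card K ≤ Fintype.card G)
    (hHK : (Fintype.card H * Fintype.card K : ℝ) ≤ M * Fintype.card G) (hM0 : 0 ≤ M) :
    FastDFT G (Fintype.card W * (cK + (cH + 2 * b) * M ^ α + 7 * b + 1) *
      (Fintype.card G : ℝ) ^ α) := by
  have hα : 1 ≤ α := by linarith [hM.two_le]
  have hb := hM.nonneg
  have h := FastDFT.of_cover φ ψ A x y hcover hM hH hK
  rw [mul_div_cancel_left₀ α two_ne_zero] at h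
  refine h.mono ?_
  rw [mul_assoc (Fintype.card W : ℝ)]
  refine mul_le_mul_of_nonneg_left ?_ (Nat.cast_nonneg _)
  have key : ∀ n : ℕ, (n : ℝ) ≤ (n : ℝ) ^ α := by
    intro n
    rcases Nat.eq_zero_or_pos n with rfl | hn
    · simpa using Real.rpow_nonneg le_rfl α
    · simpa using Real.rpow_le_rpow_of_exponent_le (show (1 : ℝ) ≤ n by exact_mod_cast hn) hα
  have h1 : (A.card : ℝ) * (cK * (Fintype.card K : ℝ) ^ α) ≤ cK * (Fintype.card G : ℝ) ^ α := by
    calc (A.card : ℝ) * (cK * (Fintype.card K : ℝ) ^ α)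
        ≤ (A.card : ℝ) ^ α * (cK * (Fintype.card K : ℝ) ^ α) := by gcongr; exact key _
      _ = cK * ((A.card * Fintype.card K : ℝ)) ^ α := by
          rw [Real.mul_rpow (by positivity) (by positivity)]; ring
      _ ≤ _ := by gcongr; exact_mod_cast hAK
  have h2 : (Fintype.card H * Fintype.card K : ℝ) ^ α ≤ M ^ α * (Fintype.card G : ℝ) ^ α := by
    rw [← Real.mul_rpow hM0 (by positivity)]
    gcongr
  have h3 : (Fintype.card K : ℝ) * (cH * (Fintype.card H : ℝ) ^ α) ≤
      cH * (M ^ α * (Fintype.card G : ℝ) ^ α) := by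
    calc (Fintype.card K : ℝ) * (cH * (Fintype.card H : ℝ) ^ α)
        ≤ (Fintype.card K : ℝ) ^ α * (cH * (Fintype.card H : ℝ) ^ α) := by gcongr; exact key _
      _ = cH * ((Fintype.card H * Fintype.card K : ℝ)) ^ α := by
          rw [Real.mul_rpow (by positivity) (by positivity)]; ring
      _ ≤ _ := by gcongr
  have h4 : 2 * b * (Fintype.card H * Fintype.card K : ℝ) ^ α ≤
      2 * b * (M ^ α * (Fintype.card G : ℝ) ^ α) := by gcongr
  linarith

/-! ### Fourier transforms of arbitrary length and DFTs of cyclic groups -/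

theorem Finset.sum_range_two_mul {M : Type*} [AddCommMonoid M] (f : ℕ → M) (n : ℕ) :
    ∑ j ∈ Finset.range (2 * n), f j = ∑ j ∈ Finset.range n, (f (2 * j) + f (2 * j + 1)) := by
  induction n with
  | zero => simp
  | succ n ih =>
    rw [show 2 * (n + 1) = 2 * n + 1 + 1 by ring, Finset.sum_range_succ, Finset.sum_range_succ, ih,
      Finset.sum_range_succ, add_assoc]

/-- The radix-two fast Fourier transform. -/
theorem fft_two_pow_cost (l : ℕ) : ∀ ζ : ℂ, ζ ^ 2 ^ l = 1 →
    CostLE (fun (x : ℕ → ℂ) (r : Fin (2 ^ l)) => ∑ j ∈ Finset.range (2 ^ l), x j * ζ ^ (j * r))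
      (2 * l * 2 ^ l) := by
  induction l with
  | zero =>
    intro ζ _
    refine (CostLE.reindex fun _ : Fin (2 ^ 0) => 0).congr (fun x r => ?_) (by simp)
    simp
  | succ l ih =>
    intro ζ hζ
    have hζ2 : (ζ ^ 2) ^ 2 ^ l = 1 := by rw [← pow_mul, ← pow_succ', hζ]
    let m : Fin (2 ^ (l + 1)) → Fin (2 ^ l) := fun r => ⟨r % 2 ^ l, Nat.mod_lt _ (by positivity)⟩
    have hE := ((ih _ hζ2).inp fun j : ℕ => 2 * j).out m
    have hO := ((ih _ hζ2).inp fun j : ℕ => 2 * j + 1).out m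
    have hO' := (CostLE.scale (fun r : Fin (2 ^ (l + 1)) => r) fun r => ζ ^ (r : ℕ)).comp hO
    refine (hE.add hO').congr (fun x r => ?_) (le_of_eq ?_)
    · have hr : ∀ j : ℕ, (ζ ^ 2) ^ (j * (m r : ℕ)) = ζ ^ (2 * j * r) := by
        intro j
        have h1 : (ζ ^ 2) ^ (r : ℕ) = (ζ ^ 2) ^ ((r : ℕ) % 2 ^ l) := by
          conv_lhs => rw [← Nat.div_add_mod (r : ℕ) (2 ^ l), pow_add, pow_mul, hζ2, one_pow, one_mul]
        rw [mul_comm j, pow_mul, ← h1, ← pow_mul, ← pow_mul]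
        congr 1; ring
      rw [show Finset.range (2 ^ (l + 1)) = Finset.range (2 * 2 ^ l) by rw [pow_succ'],
        Finset.sum_range_two_mul, Finset.sum_add_distrib, Finset.mul_sum]
      congr 1
      · exact Finset.sum_congr rfl fun j _ => by rw [hr]
      · refine Finset.sum_congr rfl fun j _ => ?_
        rw [hr, show (2 * j + 1) * (r : ℕ) = 2 * j * r + r by ring, pow_add]
        ring
    · simp [pow_succ]; ring

/-- The Vandermonde matrix of the distinct powers of ζ is invertible. The coefficients β become
constants of the circuit. -/
theorem exists_fourier_coeff {N : ℕ} {ζ : ℂ} (hζ : IsPrimitiveRoot ζ N) (f : ℕ → ℂ) :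
    ∃ β : ℕ → ℂ, ∀ r < N, f r = ∑ s ∈ Finset.range N, β s * ζ ^ (s * r) := by
  let v : Fin N → ℂ := fun s => ζ ^ (s : ℕ)
  have hv : Function.Injective v := fun s t h => Fin.ext (hζ.pow_inj s.2 t.2 h)
  have hdet : IsUnit (Matrix.vandermonde v).det :=
    isUnit_iff_ne_zero.2 (Matrix.det_vandermonde_ne_zero_iff.2 hv)
  let u : Fin N → ℂ := Matrix.vecMul (fun r : Fin N => f r) (Matrix.vandermonde v)⁻¹
  have hu : Matrix.vecMul u (Matrix.vandermonde v) = fun r : Fin N => f r := by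
    simp only [u]
    rw [Matrix.vecMul_vecMul, Matrix.nonsing_inv_mul _ hdet, Matrix.vecMul_one]
  refine ⟨fun s => if hs : s < N then u ⟨s, hs⟩ else 0, fun r hr => ?_⟩
  rw [← congrFun hu ⟨r, hr⟩, Finset.sum_range]
  simp [Matrix.vecMul, dotProduct, Matrix.vandermonde_apply, v, pow_mul]

/-- Splits the exponent jk in Bluestein's algorithm; binomials instead of halved squares avoid a
square root of w. -/
theorem Nat.add_choose_two (j k : ℕ) : (j + k).choose 2 = j.choose 2 + k.choose 2 + j * k := by
  induction j with
  | zero => simp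
  | succ j ih =>
    rw [show j + 1 + k = (j + k) + 1 by ring, Nat.choose_succ_succ' (j + k) 1,
      Nat.choose_succ_succ' j 1, ih]
    simp
    ring

/-- Bluestein's algorithm. -/
theorem chirp_transform_cost {n l : ℕ} (hl : 2 * n ≤ 2 ^ l) {w : ℂ} (hw : w ≠ 0) :
    CostLE (fun (x : ℕ → ℂ) (k : Fin n) => ∑ j ∈ Finset.range n, x j * w ^ (j * k))
      (2 * n + (4 * l + 1) * 2 ^ l) := by
  set N := 2 ^ l with hN
  have hN0 : N ≠ 0 := by positivity
  let ζ := Complex.exp (2 * Real.pi * Complex.I / N)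
  have hζ : IsPrimitiveRoot ζ N := Complex.isPrimitiveRoot_exp N hN0
  -- The chirp at j + k < 2n ≤ N becomes a combination of ζ^(sj) ζ^(sk), which separates j from k.
  obtain ⟨β, hβ⟩ := exists_fourier_coeff hζ fun r => w ^ r.choose 2
  have c₁ : CostLE (fun (x : ℕ → ℂ) (j : Fin n) => (w ^ (j : ℕ).choose 2)⁻¹ * x j) n := by
    simpa using CostLE.scale (fun j : Fin n => (j : ℕ)) fun j => (w ^ (j : ℕ).choose 2)⁻¹
  have c₂ := CostLE.select (ι := Fin n) fun j : ℕ => if hj : j < n then Sum.inl ⟨j, hj⟩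
    else Sum.inr 0
  have c₃ := fft_two_pow_cost l ζ hζ.pow_eq_one
  have c₄ := CostLE.scale (fun r : Fin N => r) fun r => β r
  have c₅ := CostLE.select (ι := Fin N) fun j : ℕ => if hj : j < N then Sum.inl ⟨j, hj⟩
    else Sum.inr 0
  have c₆ : CostLE (fun (x : Fin N → ℂ) (k : Fin n) =>
      (w ^ (k : ℕ).choose 2)⁻¹ * x ⟨k, by omega⟩) n := by
    simpa using CostLE.scale (fun k : Fin n => (⟨k, by omega⟩ : Fin N))
      fun k => (w ^ (k : ℕ).choose 2)⁻¹
  -- Twist by the inverse chirp, transform, multiply by β, transform again with the same ζ, twist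
  -- again.
  have htot := c₆.comp (c₃.comp (c₅.comp (c₄.comp (c₃.comp (c₂.comp c₁)))))
  refine htot.congr (fun x k => ?_) ?_
  · simp only [← hN]
    have h1 : ∀ s ∈ Finset.range N, (Sum.elim (fun r : Fin N => β r *
        ∑ j ∈ Finset.range N, Sum.elim (fun j : Fin n => (w ^ (j : ℕ).choose 2)⁻¹ * x j) id
          (if hj : j < n then Sum.inl ⟨j, hj⟩ else Sum.inr 0) * ζ ^ (j * (r : ℕ))) id
          (if hj : s < N then Sum.inl ⟨s, hj⟩ else Sum.inr 0) : ℂ) = 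
        ∑ j ∈ Finset.range n, (w ^ j.choose 2)⁻¹ * x j * (β s * ζ ^ (s * j)) := by
      intro s hs
      rw [dif_pos (Finset.mem_range.1 hs), Sum.elim_inl, Finset.mul_sum,
        ← Finset.sum_subset (Finset.range_mono (show n ≤ N by omega))]
      · refine Finset.sum_congr rfl fun j hj => ?_
        rw [dif_pos (Finset.mem_range.1 hj), Sum.elim_inl, mul_comm s j]
        ring
      · intro j _ hj
        rw [dif_neg (by simpa using hj)]
        simp
    have h2 : ∀ j ∈ Finset.range n, x j * w ^ (j * (k : ℕ)) = (w ^ (k : ℕ).choose 2)⁻¹ *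
        ((w ^ j.choose 2)⁻¹ * x j * ∑ s ∈ Finset.range N, β s * ζ ^ (s * (j + k))) := by
      intro j hj
      rw [← hβ _ (by have := Finset.mem_range.1 hj; omega), Nat.add_choose_two, pow_add, pow_add]
      field_simp
    rw [Finset.sum_congr rfl h2, ← Finset.mul_sum]
    congr 1
    refine Eq.trans ?_ (Finset.sum_congr rfl fun s hs =>
      congrArg (fun t => t * ζ ^ (s * (k : ℕ))) (h1 s hs)).symm
    simp only [Finset.mul_sum, Finset.sum_mul]
    rw [Finset.sum_comm]
    refine Finset.sum_congr rfl fun s _ => Finset.sum_congr rfl fun j _ => ?_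
    rw [mul_add, pow_add]
    ring
  · rw [Fintype.card_fin, hN]
    push_cast
    linarith

/-- Fourier transforms of every length `n` in nearly linear time. -/
theorem exists_fourier_transform_cost {α : ℝ} (hα : 1 < α) : ∃ C : ℝ, 0 ≤ C ∧
    ∀ n : ℕ, 0 < n → ∀ w : ℂ, w ≠ 0 →
      CostLE (fun (x : ℕ → ℂ) (k : Fin n) => ∑ j ∈ Finset.range n, x j * w ^ (j * k))
        (C * (n : ℝ) ^ α) := by
  set η := (2 : ℝ) ^ (α - 1) with hη
  have hη1 : 1 < η := Real.one_lt_rpow (by norm_num) (by linarith)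
  refine ⟨2 + (4 / (η - 1) + 1) * 4 ^ α, by have : 0 < η - 1 := by linarith
                                            positivity, fun n hn w hw => ?_⟩
  set l := Nat.clog 2 (2 * n) with hl
  refine (chirp_transform_cost (Nat.le_pow_clog (by norm_num) _) hw).mono ?_
  rw [← hl]
  have hn1 : (1 : ℝ) ≤ n := by exact_mod_cast hn
  have h1 : (2 : ℝ) ^ l ≤ 4 * n := by
    have h2 : 2 ^ (l - 1) < 2 * n := Nat.pow_pred_clog_lt_self (by norm_num) (by omega)
    have hl0 : 0 < l := Nat.clog_pos (by norm_num) (by omega)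
    have h3 : 2 ^ l = 2 * 2 ^ (l - 1) := by rw [← pow_succ']; congr 1; omega
    have h4 : 2 ^ l ≤ 4 * n := by omega
    exact_mod_cast h4
  -- Bernoulli's inequality for η = 2^(α-1) > 1 turns the factor l into η^l, and η^l 2^l = (2^l)^α.
  have h2 : (l : ℝ) ≤ η ^ l / (η - 1) := by
    rw [le_div_iff₀ (by linarith)]
    have := one_add_mul_le_pow (show (-2 : ℝ) ≤ η - 1 by linarith) l
    simp only [add_sub_cancel] at this
    linarith
  have h3 : η ^ l * 2 ^ l = ((2 : ℝ) ^ l) ^ α := by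
    rw [hη, ← Real.rpow_natCast, ← Real.rpow_natCast, ← Real.rpow_mul (by norm_num),
      ← Real.rpow_mul (by norm_num), ← Real.rpow_add (by norm_num)]
    congr 1; ring
  have h4 : ((2 : ℝ) ^ l) ^ α ≤ 4 ^ α * (n : ℝ) ^ α := by
    rw [← Real.mul_rpow (by norm_num) (by positivity)]
    gcongr
  have h5 : (n : ℝ) ≤ (n : ℝ) ^ α := by
    simpa using Real.rpow_le_rpow_of_exponent_le hn1 hα.le
  have h6 : (2 : ℝ) ^ l ≤ ((2 : ℝ) ^ l) ^ α := by
    simpa using Real.rpow_le_rpow_of_exponent_le (one_le_pow₀ (by norm_num : (1 : ℝ) ≤ 2)) hα.le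
  have h7 : (l : ℝ) * 2 ^ l ≤ ((2 : ℝ) ^ l) ^ α / (η - 1) := by
    rw [← h3, mul_div_right_comm]
    gcongr
  have h8 : 0 < η - 1 := by linarith
  calc 2 * (n : ℝ) + (4 * l + 1) * 2 ^ l = 2 * n + (4 * (l * 2 ^ l) + 2 ^ l) := by ring
    _ ≤ 2 * (n : ℝ) ^ α + (4 * (((2 : ℝ) ^ l) ^ α / (η - 1)) + ((2 : ℝ) ^ l) ^ α) := by gcongr
    _ = 2 * (n : ℝ) ^ α + (4 / (η - 1) + 1) * ((2 : ℝ) ^ l) ^ α := by ring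
    _ ≤ 2 * (n : ℝ) ^ α + (4 / (η - 1) + 1) * (4 ^ α * (n : ℝ) ^ α) := by gcongr
    _ = _ := by ring

theorem GenDFT.IrrepSystem.dim_eq_one {G : Type*} [Group G] [IsMulCommutative G]
    (R : IrrepSystem G) (i : R.index) :
    R.dim i = 1 := by
  have := R.irreducible i
  simpa using Representation.IsIrreducible.finrank_eq_one_of_isMulCommutative (toRep (R.rep i))

/-- Irreducibles are one-dimensional and send a generator to an n-th root of unity, so each output
is an entry of a length-n Fourier transform. Selecting outputs is free. -/
theorem exists_fastDFT_cyclic {α : ℝ} (hα : 1 < α) : ∃ C : ℝ, 0 ≤ C ∧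
    ∀ (G : Type) [Group G] [Fintype G] [IsCyclic G],
      FastDFT G (C * (Fintype.card G : ℝ) ^ α) := by
  obtain ⟨C, hC, h⟩ := exists_fourier_transform_cost hα
  refine ⟨C, hC, fun G _ _ _ R => ?_⟩
  have : IsMulCommutative G := IsCyclic.isMulCommutative
  obtain ⟨g, hg⟩ := IsCyclic.exists_generator (α := G)
  set n := Fintype.card G with hn
  have hn0 : 0 < n := Fintype.card_pos
  have : NeZero n := ⟨hn0.ne'⟩
  have hord : orderOf g = n := by rw [hn, ← Nat.card_eq_fintype_card, orderOf_eq_card_of_forall_mem_zpowers hg]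
  let w := Complex.exp (2 * Real.pi * Complex.I / n)
  have hw : IsPrimitiveRoot w n := Complex.isPrimitiveRoot_exp n hn0.ne'
  have hchar : ∀ p : Σ i : R.index, Fin (R.dim i) × Fin (R.dim i), ∃ k : Fin n,
      ∀ j : ℕ, R.rep p.1 (g ^ j) p.2.1 p.2.2 = w ^ (j * (k : ℕ)) := by
    rintro ⟨i, a, b⟩
    have hd := R.dim_eq_one i
    have hss : Subsingleton (Fin (R.dim i)) := by rw [hd]; infer_instance
    obtain rfl := Subsingleton.elim a b
    have hdet : ∀ x, R.rep i x a a = (R.rep i x).det := fun x =>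
      (Matrix.det_eq_elem_of_subsingleton _ _).symm
    have h1 : (R.rep i g).det ^ n = 1 := by
      rw [← Matrix.det_pow, ← map_pow, ← hord, pow_orderOf_eq_one, map_one, Matrix.det_one]
    obtain ⟨k, hk, hk'⟩ := hw.eq_pow_of_pow_eq_one h1
    refine ⟨⟨k, hk⟩, fun j => ?_⟩
    simp only
    rw [hdet, map_pow, Matrix.det_pow, ← hk', ← pow_mul, mul_comm]
  choose k hk using hchar
  have h1 := ((h n hn0 w (hw.ne_zero hn0.ne')).inp fun j : ℕ => g ^ j).out k
  refine h1.congr (fun c p => ?_) le_rfl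
  rw [dft_apply, Finset.sum_range]
  let e : Fin n ≃ G := (finCongr hord.symm).trans
    ((finEquivPowers (isOfFinOrder_of_finite g)).trans (Equiv.subtypeUnivEquiv fun x =>
      (mem_powers_iff_mem_zpowers).2 (hg x)))
  have he : ∀ j, e j = g ^ (j : ℕ) := fun j => rfl
  rw [← e.sum_comp]
  exact Finset.sum_congr rfl fun j _ => by rw [he, hk]

theorem two_le_omega : 2 ≤ omega :=
  le_csInf ⟨3, 2, matMul_cost_cube⟩ fun _ ⟨_, hb⟩ => two_le_of_matMul_bound hb

/-! ### DFTs of direct powers and of p-groups -/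

/-- Splitting off one coordinate gives an exact factorization, with M = 1 and a single cell, so each
coordinate adds C + 9b + 1. -/
theorem fastDFT_pi {b α C : ℝ} (hM : MatMulBound b (2 * α)) (hC : 0 ≤ C) {A : Type} [Group A]
    [Fintype A] (hA : FastDFT A (C * (Fintype.card A : ℝ) ^ α))
    (h0 : FastDFT (Fin 0 → A) (C * (Fintype.card (Fin 0 → A) : ℝ) ^ α)) (m : ℕ) :
    FastDFT (Fin m → A) ((C + m * (C + 9 * b + 1)) * (Fintype.card (Fin m → A) : ℝ) ^ α) := by
  classical
  have hb := hM.nonneg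
  induction m with
  | zero => simpa using h0
  | succ m ih =>
    let φ : A →* (Fin (m + 1) → A) := MonoidHom.mk' (fun a => Fin.cons a 1) fun a a' => by
      ext k; induction k using Fin.cases <;> simp
    let ψ : (Fin m → A) →* (Fin (m + 1) → A) := MonoidHom.mk' (fun f => Fin.cons 1 f) fun f f' => by
      ext k; induction k using Fin.cases <;> simp
    have h := FastDFT.of_cover_of_card_le φ ψ Finset.univ (W := Unit) 1 1
      (fun g => ⟨(), g 0, Finset.mem_univ _, Fin.tail g, by
        ext k; induction k using Fin.cases <;> simp [φ, ψ, Fin.tail]⟩) hM hA ih hC (by positivity)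
      (M := 1) (by simp [pow_succ, mul_comm]) (by simp [pow_succ, mul_comm]) zero_le_one
    refine h.mono (le_of_eq ?_)
    simp
    left
    ring

/-- For `k` prime to its order, `g` is itself a power of `g ^ k`. -/
theorem pow_not_mem_of_coprime {G : Type*} [Group G] {N : Subgroup G} {g : G} (hg : g ∉ N) {k : ℕ}
    (hk : Nat.Coprime k (orderOf g)) : g ^ k ∉ N := by
  intro h
  obtain ⟨m, hm⟩ := exists_pow_eq_self_of_coprime hk
  exact hg (hm ▸ N.pow_mem h m)

/-- Nearly linear time DFTs for `p`-groups of small exponent. -/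
theorem fastDFT_pGroup {b α C M : ℝ} (hM : MatMulBound b (2 * α)) (hC : 0 ≤ C) (hM0 : 0 ≤ M)
    (hcyc : ∀ (G : Type) [Group G] [Fintype G] [IsCyclic G],
      FastDFT G (C * (Fintype.card G : ℝ) ^ α)) {p : ℕ} [hp : Fact p.Prime] (n : ℕ) :
    ∀ (P : Type) [Group P] [Fintype P], Fintype.card P = p ^ n →
      (∀ g : P, (orderOf g : ℝ) ≤ M * p) →
      FastDFT P ((C + n * ((C + 2 * b) * M ^ α + 7 * b + 1)) * (Fintype.card P : ℝ) ^ α) := by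
  classical
  have hb := hM.nonneg
  induction n with
  | zero =>
    intro P _ _ hP _
    have : Subsingleton P := Fintype.card_le_one_iff_subsingleton.1 (by simp [hP])
    simpa using hcyc P
  | succ n ih =>
    intro P _ _ hP hord
    obtain ⟨N, hN⟩ := Sylow.exists_subgroup_card_pow_prime (G := P) p (n := n)
      (by rw [Nat.card_eq_fintype_card, hP]; exact pow_dvd_pow _ n.le_succ)
    rw [Nat.card_eq_fintype_card] at hN
    have hpg : IsPGroup p P := IsPGroup.of_card (n := n + 1) (by rw [Nat.card_eq_fintype_card, hP])
    obtain ⟨g, hg⟩ : ∃ g, g ∉ N := by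
      by_contra! hall
      have : N = ⊤ := (Subgroup.eq_top_iff' N).2 hall
      have h1 : Fintype.card N = Fintype.card P := by
        rw [← Nat.card_eq_fintype_card, ← Nat.card_eq_fintype_card, this, Subgroup.card_top]
      rw [hN, hP] at h1
      exact absurd (Nat.pow_right_injective hp.out.two_le h1) (by omega)
    -- The powers g^i with i < p lie in distinct cosets of `N`; as `N` has index p, they form a
    -- transversal.
    have hlt : ∀ i j : ℕ, i < j → j < p → ∀ x ∈ N, ∀ y ∈ N, g ^ i * x ≠ g ^ j * y := by
      intro i j hij hj x hx y hy hxy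
      refine pow_not_mem_of_coprime hg (k := j - i) ?_ ?_
      · obtain ⟨k, hk⟩ := (IsPGroup.iff_orderOf.1 hpg) g
        rw [hk]
        refine Nat.Coprime.pow_right _ (Nat.Coprime.symm ((hp.out.coprime_iff_not_dvd).2 ?_))
        exact Nat.not_dvd_of_pos_of_lt (by omega) (by omega)
      · have : g ^ (j - i) = x * y⁻¹ := by
          rw [eq_mul_inv_iff_mul_eq]
          apply mul_left_cancel (a := g ^ i)
          rw [hxy, ← mul_assoc, ← pow_add]
          congr 2; omega
        rw [this]
        exact N.mul_mem hx (N.inv_mem hy)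
    let F : Fin p × N → P := fun q => g ^ (q.1 : ℕ) * q.2
    have hF : Function.Injective F := by
      rintro ⟨i, x⟩ ⟨j, y⟩ h
      rcases lt_trichotomy i j with hij | rfl | hij
      · exact absurd h (hlt i j hij j.2 x x.2 y y.2)
      · exact Prod.ext rfl (Subtype.ext (mul_left_cancel h))
      · exact absurd h.symm (hlt j i hij i.2 y y.2 x x.2)
    have hFs : Function.Surjective F :=
      ((Fintype.bijective_iff_injective_and_card F).2 ⟨hF, by simp [hN, hP, pow_succ, mul_comm]⟩).2
    -- `g` may have order larger than p. Restricting to p of its powers keeps |A||N| ≤ |P|, so the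
    -- constant of `N` is not multiplied; the excess order costs only M^α in the cyclic and matrix
    -- terms.
    let A : Finset (Subgroup.zpowers g) :=
      (Finset.range p).image fun i => ⟨g ^ i, Subgroup.npow_mem_zpowers g i⟩
    have hA : A.card ≤ p := Finset.card_image_le.trans (by simp)
    have hcover : ∀ x, ∃ _ : Unit, ∃ a ∈ A, ∃ k : N,
        (1 : P) * (Subgroup.zpowers g).subtype a * 1 * N.subtype k = x := by
      intro x
      obtain ⟨⟨i, k⟩, rfl⟩ := hFs x
      exact ⟨(), ⟨g ^ (i : ℕ), _⟩, Finset.mem_image.2 ⟨i, by simp, rfl⟩, k, by simp [F]⟩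
    have hcard : Fintype.card (Subgroup.zpowers g) = orderOf g := Fintype.card_zpowers
    have hNP : (p : ℝ) * Fintype.card N = Fintype.card P := by
      rw [hN, hP]; push_cast; ring
    have h := FastDFT.of_cover_of_card_le (Subgroup.zpowers g).subtype N.subtype A (W := Unit)
      (fun _ => 1) (fun _ => 1) hcover hM (hcyc _)
      (ih N hN fun x => by simpa using hord x) hC (by positivity) (M := M)
      (by exact_mod_cast (mul_le_mul_of_nonneg_right (Nat.cast_le.2 hA)
            (Nat.cast_nonneg _)).trans hNP.le)
      (by rw [hcard, ← hNP, ← mul_assoc]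
          exact mul_le_mul_of_nonneg_right (hord g) (Nat.cast_nonneg _)) hM0
    refine h.mono (le_of_eq ?_)
    simp
    left
    ring

/-! ### Greedy covering by translates -/

/-- Few translates of a large set cover a finite group. -/
theorem exists_translates_cover {G : Type*} [Group G] [Fintype G] (S : Finset G)
    (hS : S.Nonempty) : ∃ T : Finset G, (∀ g, ∃ t ∈ T, t⁻¹ * g ∈ S) ∧
      (T.card : ℝ) ≤ Fintype.card G / S.card * Real.log (Fintype.card G) + 1 := by
  classical
  set n : ℝ := (Fintype.card G : ℝ) with hn
  set s : ℝ := (S.card : ℝ) with hs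
  have hn0 : 0 < n := by rw [hn]; exact_mod_cast Fintype.card_pos
  have hs0 : 0 < s := by rw [hs]; exact_mod_cast hS.card_pos
  have hsn : s ≤ n := by rw [hs, hn]; exact_mod_cast S.card_le_univ
  let U : Finset G → Finset G := fun T => Finset.univ.filter fun g => ∀ t ∈ T, t⁻¹ * g ∉ S
  have step : ∀ T : Finset G, ∃ t, ((U (insert t T)).card : ℝ) ≤ (U T).card * (1 - s / n) := by
    intro T
    -- Each uncovered element lies in exactly |S| translates, so some translate catches the average
    -- fraction s/n of what is left.
    have hsum : ∑ t : G, (((U T).filter fun g => t⁻¹ * g ∈ S).card : ℝ) = (U T).card * s := by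
      have h1 : ∀ g : G, (Finset.univ.filter fun t : G => t⁻¹ * g ∈ S).card = S.card := by
        intro g
        refine Finset.card_bij' (fun t _ => t⁻¹ * g) (fun x _ => g * x⁻¹) ?_ ?_ ?_ ?_ <;> simp
      have h2 : ∑ t : G, ((U T).filter fun g => t⁻¹ * g ∈ S).card = ∑ g ∈ U T, S.card := by
        simp only [Finset.card_filter]
        rw [Finset.sum_comm]
        refine Finset.sum_congr rfl fun g _ => ?_
        rw [← h1 g, Finset.card_filter]
      rw [Finset.sum_const, smul_eq_mul] at h2
      rw [hs]
      exact_mod_cast h2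
    obtain ⟨t, -, ht⟩ : ∃ t ∈ (Finset.univ : Finset G), (U T).card * s / n ≤
        (((U T).filter fun g => t⁻¹ * g ∈ S).card : ℝ) := by
      apply Finset.exists_le_of_sum_le Finset.univ_nonempty
      rw [hsum, Finset.sum_const, nsmul_eq_mul, Finset.card_univ, ← hn]
      field_simp
      exact le_rfl
    refine ⟨t, ?_⟩
    have h3 : U (insert t T) = (U T).filter fun g => ¬ t⁻¹ * g ∈ S := by
      ext g
      simp only [U, Finset.mem_filter, Finset.mem_univ, true_and, Finset.mem_insert,
        forall_eq_or_imp]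
      tauto
    have h4 := Finset.card_filter_add_card_filter_not (s := U T) fun g => t⁻¹ * g ∈ S
    rw [← h3] at h4
    have h5 : (((U T).filter fun g => t⁻¹ * g ∈ S).card : ℝ) + (U (insert t T)).card =
      (U T).card := by exact_mod_cast h4
    rw [mul_sub, mul_one, ← mul_div_assoc]
    linarith
  have main : ∀ k : ℕ, ∃ T : Finset G, T.card ≤ k ∧ ((U T).card : ℝ) ≤ n * (1 - s / n) ^ k := by
    intro k
    induction k with
    | zero => exact ⟨∅, by simp, by simpa using hn ▸ (Nat.cast_le.2 (Finset.card_le_univ _))⟩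
    | succ k ih =>
      obtain ⟨T, hT, hU⟩ := ih
      obtain ⟨t, ht⟩ := step T
      refine ⟨insert t T, (Finset.card_insert_le _ _).trans (by omega), ht.trans ?_⟩
      rw [pow_succ, ← mul_assoc]
      refine mul_le_mul_of_nonneg_right hU ?_
      rw [sub_nonneg, div_le_one hn0]
      exact hsn
  set L := n / s * Real.log n with hL
  have hL0 : 0 ≤ L := by
    have : 1 ≤ n := by rw [hn]; exact_mod_cast Fintype.card_pos
    have := Real.log_nonneg this
    positivity
  -- After more than (n/s) log n steps fewer than one element is left, by 1 - x ≤ exp(-x).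
  obtain ⟨T, hT, hU⟩ := main (⌊L⌋₊ + 1)
  refine ⟨T, ?_, ?_⟩
  · have hlt : ((U T).card : ℝ) < 1 := by
      refine hU.trans_lt ?_
      have h1 : (1 - s / n) ≤ Real.exp (-(s / n)) := by
        have := Real.add_one_le_exp (-(s / n)); linarith
      have h0 : 0 ≤ 1 - s / n := by rw [sub_nonneg, div_le_one hn0]; exact hsn
      calc n * (1 - s / n) ^ (⌊L⌋₊ + 1) ≤ n * Real.exp (-(s / n)) ^ (⌊L⌋₊ + 1) := by gcongr
        _ = n * Real.exp (-(s / n * (⌊L⌋₊ + 1 : ℕ))) := by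
            rw [← Real.exp_nat_mul]; congr 2; ring
        _ < n * Real.exp (-(Real.log n)) := by
            have h2 : L < (⌊L⌋₊ + 1 : ℕ) := by push_cast; exact Nat.lt_floor_add_one L
            have h3 : Real.log n < s / n * (⌊L⌋₊ + 1 : ℕ) := by
              calc Real.log n = s / n * L := by rw [hL]; field_simp
                _ < _ := by gcongr
            gcongr
        _ = 1 := by rw [Real.exp_neg, Real.exp_log hn0]; field_simp
    have h0 : (U T).card = 0 := by
      have : (U T).card < 1 := by exact_mod_cast hlt
      omega
    intro g
    by_contra! hcon
    have : g ∈ U T := by simpa [U] using hcon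
    rw [Finset.card_eq_zero.1 h0] at this
    simp at this
  · calc (T.card : ℝ) ≤ (⌊L⌋₊ + 1 : ℕ) := by exact_mod_cast hT
      _ ≤ L + 1 := by push_cast; gcongr; exact Nat.floor_le hL0

/-! ### Unitriangular matrices -/

/-- `A - 1` is strictly upper triangular with respect to the positions `pos`. -/
def IsUnitri {ι K : Type*} [DecidableEq ι] [Field K] (pos : ι → ℕ) (A : Matrix ι ι K) : Prop :=
  ∀ i j, pos j ≤ pos i → A i j = (1 : Matrix ι ι K) i j

theorem IsUnitri.one {ι K : Type*} [DecidableEq ι] [Field K] (pos : ι → ℕ) :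
    IsUnitri pos (1 : Matrix ι ι K) := fun _ _ _ => rfl

theorem IsUnitri.mul {ι K : Type*} [DecidableEq ι] [Fintype ι] [Field K] {pos : ι → ℕ}
    {A B : Matrix ι ι K} (hA : IsUnitri pos A)
    (hB : IsUnitri pos B) : IsUnitri pos (A * B) := by
  intro i j hij
  rw [Matrix.mul_apply, Finset.sum_eq_single i]
  · rw [hA i i le_rfl, Matrix.one_apply_eq, one_mul, hB i j hij]
  · intro k _ hk
    rcases lt_or_ge (pos i) (pos k) with h | h
    · rw [hB k j (hij.trans h.le), Matrix.one_apply_ne, mul_zero]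
      rintro rfl
      exact absurd h (not_lt.2 hij)
    · rw [hA i k h, Matrix.one_apply_ne hk.symm, zero_mul]
  · simp

theorem IsUnitri.pow {ι K : Type*} [DecidableEq ι] [Fintype ι] [Field K] {pos : ι → ℕ}
    {A : Matrix ι ι K} (hA : IsUnitri pos A) (n : ℕ) :
    IsUnitri pos (A ^ n) := by
  induction n with
  | zero => simpa using IsUnitri.one pos
  | succ n ih => rw [pow_succ]; exact ih.mul hA

/-- In characteristic p, (1 + N)^(p^k) = 1 + N^(p^k), and N^(p^k) vanishes once p^k exceeds all
positions. -/
theorem IsUnitri.pow_prime_pow_eq_one {ι K : Type*} [DecidableEq ι] [Fintype ι] [Field K]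
    {pos : ι → ℕ} {A : Matrix ι ι K} (hA : IsUnitri pos A)
    (p : ℕ) [Fact p.Prime] [CharP K p] {k : ℕ} (hk : ∀ i, pos i < p ^ k) : A ^ p ^ k = 1 := by
  rcases isEmpty_or_nonempty ι with h | h
  · exact Subsingleton.elim _ _
  set N := A - 1 with hN
  have hN0 : ∀ i j, pos j ≤ pos i → N i j = 0 := fun i j hij => by
    rw [hN, Matrix.sub_apply, hA i j hij, sub_self]
  have hpow : ∀ n i j, pos j < pos i + n → (N ^ n) i j = 0 := by
    intro n
    induction n with
    | zero =>
      intro i j hij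
      rw [pow_zero, Matrix.one_apply_ne]
      rintro rfl
      simp at hij
    | succ n ih =>
      intro i j hij
      rw [pow_succ, Matrix.mul_apply]
      refine Finset.sum_eq_zero fun l _ => ?_
      rcases lt_or_ge (pos l) (pos i + n) with h | h
      · rw [ih i l h, zero_mul]
      · rw [hN0 l j (by omega), mul_zero]
  have hz : N ^ p ^ k = 0 := by
    ext i j
    exact hpow _ i j (by have := hk j; omega)
  have hA1 : A = N + 1 := by rw [hN, sub_add_cancel]
  rw [hA1, add_pow_char_pow_of_commute p k (Commute.one_right N), hz, one_pow, zero_add]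

/-- Over a finite field the inverse is a power, so unitriangularity of inverses follows from that of
products. -/
theorem IsUnitri.exists_mul_pow_eq_one {ι K : Type*} [DecidableEq ι] [Fintype ι] [Field K] [Finite K]
    {pos : ι → ℕ} {A : Matrix ι ι K} (hA : IsUnitri pos A) :
    ∃ n, A * A ^ n = 1 := by
  obtain ⟨p, hp⟩ := CharP.exists K
  have : Fact p.Prime := ⟨CharP.char_is_prime K p⟩
  obtain ⟨N, hN⟩ : ∃ N, ∀ i, pos i < N :=
    ⟨Finset.univ.sup pos + 1, fun i => Nat.lt_succ_of_le (Finset.le_sup (Finset.mem_univ i))⟩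
  have hk : ∀ i, pos i < p ^ N := fun i => (hN i).trans (Nat.lt_pow_self (Fact.out : p.Prime).one_lt)
  refine ⟨p ^ N - 1, ?_⟩
  rw [← pow_succ', Nat.sub_add_cancel (Nat.one_le_pow _ _ (Fact.out : p.Prime).pos),
    hA.pow_prime_pow_eq_one p hk]

theorem IsUnitri.inv {ι K : Type*} [DecidableEq ι] [Fintype ι] [Field K] [Finite K]
    {pos : ι → ℕ} {A : Matrix ι ι K} (hA : IsUnitri pos A) :
    IsUnitri pos A⁻¹ := by
  obtain ⟨n, hn⟩ := hA.exists_mul_pow_eq_one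
  rw [Matrix.inv_eq_right_inv hn]
  exact hA.pow n

theorem IsUnitri.inv_mul {ι K : Type*} [DecidableEq ι] [Fintype ι] [Field K] [Finite K]
    {pos : ι → ℕ} {A : Matrix ι ι K} (hA : IsUnitri pos A) : A⁻¹ * A = 1 := by
  obtain ⟨n, hn⟩ := hA.exists_mul_pow_eq_one
  rw [Matrix.inv_eq_right_inv hn]
  exact mul_eq_one_comm.1 hn

/-! ### The orthogonal group of plus type -/

section PlusOrthogonal

variable {m : ℕ} {K : Type} [Field K]

/-- The position of a basis vector in the total order of the basis. -/
def plusPos (m : ℕ) : Fin m ⊕ Fin m → ℕ := Sum.elim (fun i => i) fun i => m + i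

/-- The order-reversing permutation of the basis. -/
def plusRev (m : ℕ) : Fin m ⊕ Fin m → Fin m ⊕ Fin m :=
  Sum.elim (fun i => Sum.inr i.rev) fun i => Sum.inl i.rev

theorem plusPos_lt (x : Fin m ⊕ Fin m) : plusPos m x < 2 * m := by
  rcases x with i | i <;> simp only [plusPos, Sum.elim_inl, Sum.elim_inr] <;> omega

theorem plusPos_injective : Function.Injective (plusPos m) := by
  rintro (i | i) (j | j) h <;> simp only [plusPos, Sum.elim_inl, Sum.elim_inr] at h
  · rw [Fin.ext h]
  · omega
  · omega
  · rw [Fin.ext (by omega : (i : ℕ) = j)]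

theorem plusRev_plusRev (x : Fin m ⊕ Fin m) : plusRev m (plusRev m x) = x := by
  rcases x with i | i <;> simp [plusRev]

theorem plusRev_involutive : Function.Involutive (plusRev m) := plusRev_plusRev

theorem plusPos_plusRev (x : Fin m ⊕ Fin m) : plusPos m (plusRev m x) + plusPos m x + 1 = 2 * m := by
  rcases x with i | i <;> simp [plusPos, plusRev, Fin.val_rev] <;> omega

theorem plusForm_apply (x y : Fin m ⊕ Fin m) :
    plusForm m K x y = if y = plusRev m x then 1 else 0 := by
  rcases x with i | i <;> rcases y with j | j <;> simp [plusForm, plusRev, antidiag]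

theorem plusForm_mul_apply {n : Type*} (M : Matrix (Fin m ⊕ Fin m) n K) (x : Fin m ⊕ Fin m) (y : n) :
    (plusForm m K * M) x y = M (plusRev m x) y := by
  simp [Matrix.mul_apply, plusForm_apply]

theorem mul_plusForm_apply {n : Type*} (M : Matrix n (Fin m ⊕ Fin m) K) (x : n) (y : Fin m ⊕ Fin m) :
    (M * plusForm m K) x y = M x (plusRev m y) := by
  have : ∀ z, (y = plusRev m z) = (z = plusRev m y) := fun z => propext
    ⟨fun h => by rw [h, plusRev_plusRev], fun h => by rw [h, plusRev_plusRev]⟩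
  simp [Matrix.mul_apply, plusForm_apply, this]

theorem plusForm_mul_self : plusForm m K * plusForm m K = 1 := by
  ext x y
  rw [plusForm_mul_apply, plusForm_apply, plusRev_plusRev, Matrix.one_apply]
  simp [eq_comm]

theorem plusForm_transpose : (plusForm m K).transpose = plusForm m K := by
  ext x y
  have : (x = plusRev m y) = (y = plusRev m x) := propext
    ⟨fun h => by rw [h, plusRev_plusRev], fun h => by rw [h, plusRev_plusRev]⟩
  simp [plusForm_apply, this]

/-- The matrix of an element of the orthogonal group. -/
def plusMat (A : plusOrthogonalGroup m K) : Matrix (Fin m ⊕ Fin m) (Fin m ⊕ Fin m) K := A.1.1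

theorem plusMat_injective : Function.Injective (plusMat : plusOrthogonalGroup m K → _) :=
  fun _ _ h => Subtype.ext (Units.ext h)

theorem plusMat_mul (A B : plusOrthogonalGroup m K) : plusMat (A * B) = plusMat A * plusMat B := rfl

theorem plusMat_one : plusMat (1 : plusOrthogonalGroup m K) = 1 := rfl

theorem plusMat_pow (A : plusOrthogonalGroup m K) (n : ℕ) : plusMat (A ^ n) = plusMat A ^ n := rfl

theorem plusMat_mem (A : plusOrthogonalGroup m K) :
    (plusMat A).transpose * plusForm m K * plusMat A = plusForm m K := A.2

theorem plusMat_apply_mul_apply (A : plusOrthogonalGroup m K) (x y : Fin m ⊕ Fin m) :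
    ∑ z, plusMat A z x * plusMat A (plusRev m z) y = if y = plusRev m x then 1 else 0 := by
  rw [← plusForm_apply (K := K), ← plusMat_mem A, Matrix.mul_assoc, Matrix.mul_apply]
  simp only [plusForm_mul_apply, Matrix.transpose_apply]

/-- The element of the orthogonal group with a given matrix. -/
def plusMk (A : Matrix (Fin m ⊕ Fin m) (Fin m ⊕ Fin m) K)
    (h : A.transpose * plusForm m K * A = plusForm m K) : plusOrthogonalGroup m K :=
  have h1 : plusForm m K * A.transpose * plusForm m K * A = 1 := by
    rw [Matrix.mul_assoc, Matrix.mul_assoc, ← Matrix.mul_assoc A.transpose, h, plusForm_mul_self]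
  ⟨⟨A, plusForm m K * A.transpose * plusForm m K, mul_eq_one_comm.1 h1, h1⟩, h⟩

theorem plusMat_plusMk (A : Matrix (Fin m ⊕ Fin m) (Fin m ⊕ Fin m) K)
    (h : A.transpose * plusForm m K * A = plusForm m K) : plusMat (plusMk A h) = A := rfl

theorem plusMat_inv (A : plusOrthogonalGroup m K) :
    plusMat A⁻¹ = plusForm m K * (plusMat A).transpose * plusForm m K := by
  have h1 : plusMat A⁻¹ * plusMat A = 1 := by rw [← plusMat_mul, inv_mul_cancel, plusMat_one]
  have h2 : plusForm m K * (plusMat A).transpose * plusForm m K * plusMat A = 1 := by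
    rw [Matrix.mul_assoc, Matrix.mul_assoc, ← Matrix.mul_assoc (plusMat A).transpose, plusMat_mem,
      plusForm_mul_self]
  exact left_inv_eq_right_inv h1 (mul_eq_one_comm.1 h2)

theorem plusMat_inv_apply (A : plusOrthogonalGroup m K) (x y : Fin m ⊕ Fin m) :
    plusMat A⁻¹ x y = plusMat A (plusRev m y) (plusRev m x) := by
  rw [plusMat_inv, mul_plusForm_apply, plusForm_mul_apply, Matrix.transpose_apply]

/-- The longest Weyl group element. -/
def plusReversal (m : ℕ) (K : Type) [Field K] : plusOrthogonalGroup m K :=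
  plusMk (plusForm m K) (by rw [plusForm_transpose, plusForm_mul_self, Matrix.one_mul])

theorem plusReversal_conj_apply (A : plusOrthogonalGroup m K) (x y : Fin m ⊕ Fin m) :
    plusMat (plusReversal m K * A * (plusReversal m K)⁻¹) x y =
      plusMat A (plusRev m x) (plusRev m y) := by
  have : (plusReversal m K)⁻¹ = plusReversal m K :=
    inv_eq_of_mul_eq_one_left (plusMat_injective plusForm_mul_self)
  rw [this, plusMat_mul, plusMat_mul]
  show (plusForm m K * plusMat A * plusForm m K) x y = _
  rw [mul_plusForm_apply, plusForm_mul_apply]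

/-- The unipotent radical of the standard Borel subgroup. -/
def plusUnipotent (m : ℕ) (K : Type) [Field K] : Subgroup (plusOrthogonalGroup m K) where
  carrier := {A | IsUnitri (plusPos m) (plusMat A)}
  one_mem' := IsUnitri.one _
  mul_mem' := fun hA hB => IsUnitri.mul hA hB
  inv_mem' := by
    intro A hA x y hxy
    have h1 := plusPos_plusRev x
    have h2 := plusPos_plusRev y
    rw [plusMat_inv_apply, hA _ _ (by omega)]
    simp only [Matrix.one_apply, plusRev_involutive.injective.eq_iff, eq_comm]

/-- The standard Borel subgroup. -/
def plusBorel (m : ℕ) (K : Type) [Field K] : Subgroup (plusOrthogonalGroup m K) where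
  carrier := {A | ∀ x y, plusPos m y < plusPos m x → plusMat A x y = 0}
  one_mem' := fun x y h => Matrix.one_apply_ne fun hxy => by simp [hxy] at h
  mul_mem' := by
    intro A B hA hB x y h
    rw [plusMat_mul, Matrix.mul_apply]
    refine Finset.sum_eq_zero fun z _ => ?_
    rcases lt_or_ge (plusPos m z) (plusPos m x) with hz | hz
    · rw [hA _ _ hz, zero_mul]
    · rw [hB _ _ (h.trans_le hz), mul_zero]
  inv_mem' := by
    intro A hA x y hxy
    have h1 := plusPos_plusRev x
    have h2 := plusPos_plusRev y
    rw [plusMat_inv_apply, hA _ _ (by omega)]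

theorem mem_plusUnipotent {A : plusOrthogonalGroup m K} :
    A ∈ plusUnipotent m K ↔ IsUnitri (plusPos m) (plusMat A) := Iff.rfl

theorem plusUnipotent_le_plusBorel : plusUnipotent m K ≤ plusBorel m K := by
  intro A hA x y hxy
  rw [mem_plusUnipotent.1 hA x y hxy.le, Matrix.one_apply_ne]
  rintro rfl
  exact lt_irrefl _ hxy

/-- Conjugation by the reversal makes `u` lower unitriangular, and `b` is upper triangular, so both
are the identity. This is the injectivity of the big cell map. -/
theorem plusBorel_inter_opposite {b u : plusOrthogonalGroup m K} (hb : b ∈ plusBorel m K)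
    (hu : u ∈ plusUnipotent m K)
    (h : b = plusReversal m K * u * (plusReversal m K)⁻¹) : u = 1 := by
  apply plusMat_injective
  ext x y
  rcases le_or_gt (plusPos m y) (plusPos m x) with hxy | hxy
  · rw [mem_plusUnipotent.1 hu x y hxy, plusMat_one]
  · have h1 := plusPos_plusRev x
    have h2 := plusPos_plusRev y
    have h3 := plusReversal_conj_apply u (plusRev m x) (plusRev m y)
    rw [← h, hb _ _ (by omega), plusRev_plusRev, plusRev_plusRev] at h3
    rw [← h3, plusMat_one, Matrix.one_apply_ne]
    rintro rfl
    exact lt_irrefl _ hxy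

/-- The diagonal entries of an element of the standard torus. -/
def plusTorusDiag (t : Fin m → Kˣ) : Fin m ⊕ Fin m → Kˣ := Sum.elim t fun i => (t i.rev)⁻¹

theorem plusTorusDiag_mul_plusRev (t : Fin m → Kˣ) (x : Fin m ⊕ Fin m) :
    plusTorusDiag t x * plusTorusDiag t (plusRev m x) = 1 := by
  rcases x with i | i <;> simp [plusTorusDiag, plusRev]

/-- The standard maximal torus. -/
def plusTorus (m : ℕ) (K : Type) [Field K] : (Fin m → Kˣ) →* plusOrthogonalGroup m K :=
  MonoidHom.mk' (fun t => plusMk (Matrix.diagonal fun x => (plusTorusDiag t x : K)) (by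
    ext x y
    rw [Matrix.diagonal_transpose, Matrix.mul_diagonal, Matrix.diagonal_mul, plusForm_apply]
    split_ifs with h
    · rw [h, mul_one]
      rw [← Units.val_mul, plusTorusDiag_mul_plusRev, Units.val_one]
    · simp)) fun s t => by
    apply plusMat_injective
    rw [plusMat_mul]
    simp only [plusMat_plusMk, Matrix.diagonal_mul_diagonal]
    congr 1
    ext x
    rcases x with i | i <;> simp [plusTorusDiag, mul_comm]

theorem plusMat_plusTorus (t : Fin m → Kˣ) :
    plusMat (plusTorus m K t) = Matrix.diagonal fun x => (plusTorusDiag t x : K) := rfl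

theorem plusTorus_mem_plusBorel (t : Fin m → Kˣ) : plusTorus m K t ∈ plusBorel m K := by
  intro x y hxy
  rw [plusMat_plusTorus, Matrix.diagonal_apply_ne]
  rintro rfl
  exact lt_irrefl _ hxy

/-- Pair column x with column `plusRev m x`: triangularity kills every term but the diagonal one.
Hence the diagonal is that of a torus element. -/
theorem plusBorel_diag_mul {A : plusOrthogonalGroup m K} (hA : A ∈ plusBorel m K)
    (x : Fin m ⊕ Fin m) : plusMat A x x * plusMat A (plusRev m x) (plusRev m x) = 1 := by
  have h := plusMat_apply_mul_apply A x (plusRev m x)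
  rw [if_pos rfl, Finset.sum_eq_single x] at h
  · exact h
  · intro z _ hz
    rcases lt_or_gt_of_ne (plusPos_injective.ne hz) with hlt | hlt
    · have h1 := plusPos_plusRev x
      have h2 := plusPos_plusRev z
      rw [hA (plusRev m z) _ (by omega), mul_zero]
    · rw [hA z x hlt, zero_mul]
  · simp

theorem exists_torus_mul_unipotent {A : plusOrthogonalGroup m K} (hA : A ∈ plusBorel m K) :
    ∃ t, ∃ u ∈ plusUnipotent m K, plusTorus m K t * u = A := by
  have hne : ∀ x, plusMat A x x ≠ 0 := fun x => left_ne_zero_of_mul_eq_one (plusBorel_diag_mul hA x)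
  let t : Fin m → Kˣ := fun i => Units.mk0 _ (hne (Sum.inl i))
  have ht : ∀ x, (plusTorusDiag t x : K) = plusMat A x x := by
    rintro (i | i)
    · rfl
    · have := plusBorel_diag_mul hA (Sum.inr i)
      simp only [plusTorusDiag, Sum.elim_inr, t, Units.val_inv_eq_inv_val, Units.val_mk0]
      exact inv_eq_of_mul_eq_one_left this
  refine ⟨t, (plusTorus m K t)⁻¹ * A, ?_, by simp⟩
  have hB : (plusTorus m K t)⁻¹ * A ∈ plusBorel m K :=
    mul_mem (inv_mem (plusTorus_mem_plusBorel t)) hA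
  rw [mem_plusUnipotent]
  intro x y hxy
  rcases hxy.lt_or_eq with hlt | heq
  · rw [hB x y hlt, Matrix.one_apply_ne]
    rintro rfl
    exact lt_irrefl _ hlt
  · obtain rfl := plusPos_injective heq
    rw [← map_inv, plusMat_mul, plusMat_plusTorus, Matrix.diagonal_mul, Matrix.one_apply_eq, ← ht y,
      ← Units.val_mul]
    have : plusTorusDiag t⁻¹ y = (plusTorusDiag t y)⁻¹ := by
      rcases y with i | i <;> simp [plusTorusDiag]
    rw [this, inv_mul_cancel, Units.val_one]

theorem torus_mul_unipotent_injective {t t' : Fin m → Kˣ} {u u' : plusOrthogonalGroup m K}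
    (hu : u ∈ plusUnipotent m K) (hu' : u' ∈ plusUnipotent m K)
    (h : plusTorus m K t * u = plusTorus m K t' * u') : t = t' := by
  funext i
  have h1 := congrArg (fun A => plusMat A (Sum.inl i) (Sum.inl i)) h
  simp only [plusMat_mul, plusMat_plusTorus, Matrix.diagonal_mul,
    mem_plusUnipotent.1 hu _ _ le_rfl, mem_plusUnipotent.1 hu' _ _ le_rfl, Matrix.one_apply_eq,
    mul_one] at h1
  exact Units.ext h1

end PlusOrthogonal

/-! ### Orders of the unipotent radical and of the orthogonal group -/

section PlusCount

variable {m : ℕ} {K : Type} [Field K]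

/-- The positions above the diagonal of an `m × m` matrix. -/
abbrev StrictPairs (m : ℕ) : Type := {p : Fin m × Fin m // p.1 < p.2}

theorem card_strictPairs (m : ℕ) : Fintype.card (StrictPairs m) = ∑ k ∈ Finset.range m, k := by
  rw [Fintype.card_subtype, Finset.card_filter, Fintype.sum_prod_type, Finset.sum_comm,
    Finset.sum_range]
  refine Finset.sum_congr rfl fun j _ => ?_
  rw [← Finset.card_filter]
  have h : (Finset.univ.filter fun i : Fin m => i < j) = Finset.Iio j := by ext; simp
  exact (congrArg Finset.card h).trans (Fin.card_Iio j)

theorem antidiag_mul_apply (M : Matrix (Fin m) (Fin m) K) (i j : Fin m) :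
    (antidiag m K * M) i j = M i.rev j := by
  simp [Matrix.mul_apply, antidiag]

theorem mul_antidiag_apply (M : Matrix (Fin m) (Fin m) K) (i j : Fin m) :
    (M * antidiag m K) i j = M i j.rev := by
  have : ∀ z : Fin m, (j = z.rev) = (z = j.rev) := fun z => propext
    ⟨fun h => by rw [h, Fin.rev_rev], fun h => by rw [h, Fin.rev_rev]⟩
  simp [Matrix.mul_apply, antidiag, this]

theorem antidiag_mul_self : antidiag m K * antidiag m K = 1 := by
  ext i j
  rw [antidiag_mul_apply, Matrix.one_apply]
  simp [antidiag, eq_comm]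

theorem antidiag_transpose : (antidiag m K).transpose = antidiag m K := by
  ext i j
  have : (i = j.rev) = (j = i.rev) := propext
    ⟨fun h => by rw [h, Fin.rev_rev], fun h => by rw [h, Fin.rev_rev]⟩
  simp [antidiag, this]

/-- The strictly upper triangular matrix with given entries. -/
def strictMat (f : StrictPairs m → K) : Matrix (Fin m) (Fin m) K :=
  Matrix.of fun i j => if h : i < j then f ⟨(i, j), h⟩ else 0

theorem isUnitri_one_add_strictMat (f : StrictPairs m → K) :
    IsUnitri (fun i : Fin m => (i : ℕ)) (1 + strictMat f) := by
  intro i j hij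
  have : ¬ i < j := not_lt.2 hij
  simp [strictMat, this]

/-- The Levi part of the unipotent radical. -/
noncomputable def leviUnipotent [Finite K] (f : StrictPairs m → K) : plusOrthogonalGroup m K :=
  plusMk (Matrix.fromBlocks (1 + strictMat f) 0 0
    (antidiag m K * ((1 + strictMat f)⁻¹).transpose * antidiag m K)) (by
    have h1 : (1 + strictMat f).transpose * antidiag m K *
        (antidiag m K * ((1 + strictMat f)⁻¹).transpose * antidiag m K) = antidiag m K := by
      calc _ = (1 + strictMat f).transpose * (antidiag m K * antidiag m K) *
            ((1 + strictMat f)⁻¹).transpose * antidiag m K := by simp only [Matrix.mul_assoc]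
        _ = ((1 + strictMat f)⁻¹ * (1 + strictMat f)).transpose * antidiag m K := by
            rw [antidiag_mul_self, Matrix.mul_one, Matrix.transpose_mul]
        _ = _ := by rw [(isUnitri_one_add_strictMat f).inv_mul, Matrix.transpose_one,
                      Matrix.one_mul]
    have h2 : (antidiag m K * ((1 + strictMat f)⁻¹).transpose * antidiag m K).transpose *
        antidiag m K * (1 + strictMat f) = antidiag m K := by
      have h3 := congrArg Matrix.transpose h1
      simp only [Matrix.transpose_mul, antidiag_transpose, Matrix.transpose_transpose,
        Matrix.mul_assoc] at h3 ⊢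
      exact h3
    rw [plusForm, Matrix.fromBlocks_transpose, Matrix.fromBlocks_multiply,
      Matrix.fromBlocks_multiply]
    simp only [Matrix.transpose_zero, Matrix.zero_mul, Matrix.mul_zero, add_zero, zero_add]
    rw [h1, h2])

/-- The abelian part of the unipotent radical. -/
noncomputable def siegelUnipotent (g : StrictPairs m → K) : plusOrthogonalGroup m K :=
  plusMk (Matrix.fromBlocks 1 (antidiag m K * (strictMat g - (strictMat g).transpose)) 0 1) (by
    have h1 : (antidiag m K * (strictMat g - (strictMat g).transpose)).transpose * antidiag m K =
        (strictMat g).transpose - strictMat g := by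
      rw [Matrix.transpose_mul, Matrix.mul_assoc, antidiag_transpose, antidiag_mul_self,
        Matrix.mul_one, Matrix.transpose_sub, Matrix.transpose_transpose]
    rw [plusForm, Matrix.fromBlocks_transpose, Matrix.fromBlocks_multiply,
      Matrix.fromBlocks_multiply]
    simp only [Matrix.transpose_zero, Matrix.transpose_one, Matrix.zero_mul, Matrix.mul_zero,
      Matrix.one_mul, Matrix.mul_one, add_zero, zero_add, h1]
    rw [← Matrix.mul_assoc, antidiag_mul_self, Matrix.one_mul]
    simp)

theorem leviUnipotent_mem [Finite K] (f : StrictPairs m → K) :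
    leviUnipotent f ∈ plusUnipotent m K := by
  have hf := isUnitri_one_add_strictMat f
  rw [mem_plusUnipotent, leviUnipotent, plusMat_plusMk]
  rintro (i | i) (j | j) hij <;> simp only [plusPos, Sum.elim_inl, Sum.elim_inr] at hij
  · rw [Matrix.fromBlocks_apply₁₁, hf i j hij]
    simp [Matrix.one_apply]
  · simp
  · simp
  · rw [Matrix.fromBlocks_apply₂₂, mul_antidiag_apply, antidiag_mul_apply, Matrix.transpose_apply,
      hf.inv]
    · simp [Matrix.one_apply, eq_comm]
    · simp only [Fin.val_rev]; omega

theorem siegelUnipotent_mem (g : StrictPairs m → K) : siegelUnipotent g ∈ plusUnipotent m K := by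
  rw [mem_plusUnipotent, siegelUnipotent, plusMat_plusMk]
  rintro (i | i) (j | j) hij <;> simp only [plusPos, Sum.elim_inl, Sum.elim_inr] at hij
  · simp [Matrix.one_apply]
  · omega
  · simp
  · simp [Matrix.one_apply]

theorem strictMat_injective : Function.Injective (strictMat : (StrictPairs m → K) → _) := by
  intro f g h
  ext ⟨⟨i, j⟩, hij⟩
  have := congrFun (congrFun h i) j
  simpa [strictMat, show i < j from hij] using this

/-- The products of a Levi and a Siegel element are pairwise distinct: the upper left block recovers
the first factor, then the upper right block the second. -/
theorem card_plusUnipotent_ge [Fintype K] :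
    Fintype.card K ^ (2 * Fintype.card (StrictPairs m)) ≤ Nat.card (plusUnipotent m K) := by
  classical
  let F : (StrictPairs m → K) × (StrictPairs m → K) → plusUnipotent m K := fun p =>
    ⟨leviUnipotent p.1 * siegelUnipotent p.2,
      mul_mem (leviUnipotent_mem p.1) (siegelUnipotent_mem p.2)⟩
  have hF : Function.Injective F := by
    rintro ⟨f, g⟩ ⟨f', g'⟩ h
    have h1 : plusMat (leviUnipotent f * siegelUnipotent g) =
      plusMat (leviUnipotent f' * siegelUnipotent g') := congrArg (fun A => plusMat A.1) h
    rw [plusMat_mul, plusMat_mul, leviUnipotent, leviUnipotent, siegelUnipotent, siegelUnipotent,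
      plusMat_plusMk, plusMat_plusMk, plusMat_plusMk, plusMat_plusMk, Matrix.fromBlocks_multiply,
      Matrix.fromBlocks_multiply, Matrix.fromBlocks_inj] at h1
    simp only [Matrix.mul_one, Matrix.mul_zero, Matrix.zero_mul, add_zero, zero_add] at h1
    obtain ⟨h2, h3, -, -⟩ := h1
    obtain rfl := strictMat_injective (add_left_cancel h2)
    have h4 := congrArg (fun M => antidiag m K * ((1 + strictMat f)⁻¹ * M)) h3
    simp only [← Matrix.mul_assoc, (isUnitri_one_add_strictMat f).inv_mul] at h4
    simp only [Matrix.mul_one, antidiag_mul_self, Matrix.one_mul] at h4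
    have h5 : g = g' := by
      ext ⟨⟨i, j⟩, hij⟩
      have hij' : i < j := hij
      have := congrFun (congrFun h4 i) j
      simpa [strictMat, hij', hij'.le, not_lt.2 hij'.le] using this
    rw [h5]
  have := Nat.card_le_card_of_injective F hF
  simpa [Nat.card_eq_fintype_card, ← pow_add, two_mul] using this

theorem card_filter_quadratic_le [Fintype K] [DecidableEq K] {a : K} (ha : a ≠ 0) (b c : K) :
    (Finset.univ.filter fun t : K => a * t ^ 2 + b * t + c = 0).card ≤ 2 := by
  let p : Polynomial K := Polynomial.C a * Polynomial.X ^ 2 + Polynomial.C b * Polynomial.X +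
    Polynomial.C c
  have hp : p.natDegree = 2 := Polynomial.natDegree_quadratic ha
  have hp0 : p ≠ 0 := by
    intro h
    rw [h, Polynomial.natDegree_zero] at hp
    omega
  calc _ ≤ p.roots.toFinset.card := by
        refine Finset.card_le_card fun t ht => ?_
        rw [Multiset.mem_toFinset, Polynomial.mem_roots hp0, Polynomial.IsRoot]
        simpa [p] using ht
    _ ≤ Multiset.card p.roots := p.roots.toFinset_card_le
    _ ≤ 2 := hp ▸ p.card_roots'

/-- The number of isotropic vectors orthogonal to the first `k` basis vectors. -/
theorem card_isotropic_le [Fintype K] [DecidableEq K] (h2 : (2 : K) ≠ 0) (k : Fin m) :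
    (Finset.univ.filter fun v : Fin m ⊕ Fin m → K => (∀ i < k, v (Sum.inr i.rev) = 0) ∧
      ∑ x, v x * v (plusRev m x) = 0).card ≤ 2 * Fintype.card K ^ (2 * m - k - 1) := by
  set q := Fintype.card K with hq
  have hq0 : 0 < q := Fintype.card_pos
  set V := Finset.univ.filter fun v : Fin m ⊕ Fin m → K => ∀ i < k, v (Sum.inr i.rev) = 0 with hV
  set X := Finset.univ.filter fun v : Fin m ⊕ Fin m → K => (∀ i < k, v (Sum.inr i.rev) = 0) ∧
      ∑ x, v x * v (plusRev m x) = 0 with hX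
  have hVc : V.card ≤ q ^ (2 * m - k) := by
    let T : Finset (Fin m ⊕ Fin m) :=
      (Finset.univ.filter fun i : Fin m => i < k).image fun i => Sum.inr i.rev
    have hT : T.card = k := by
      rw [Finset.card_image_of_injective _ fun i j h => Fin.rev_injective (Sum.inr_injective h)]
      have h : (Finset.univ.filter fun i : Fin m => i < k) = Finset.Iio k := by ext; simp
      rw [h, Fin.card_Iio]
    have hTc : Fintype.card {x // x ∈ Tᶜ} = 2 * m - k := by
      rw [Fintype.card_coe, Finset.card_compl, hT, Fintype.card_sum, Fintype.card_fin, two_mul]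
    have hinj : Set.InjOn (fun (v : Fin m ⊕ Fin m → K) (x : {x // x ∈ Tᶜ}) => v x) V := by
      intro v hv v' hv' h
      ext x
      by_cases hx : x ∈ T
      · obtain ⟨i, hi, rfl⟩ := Finset.mem_image.1 hx
        have hi' : i < k := (Finset.mem_filter.1 hi).2
        rw [(Finset.mem_filter.1 hv).2 i hi', (Finset.mem_filter.1 hv').2 i hi']
      · exact congrFun h ⟨x, Finset.mem_compl.2 hx⟩
    calc V.card = (V.image fun v (x : {x // x ∈ Tᶜ}) => v x).card :=
          (Finset.card_image_of_injOn hinj).symm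
      _ ≤ Fintype.card ({x // x ∈ Tᶜ} → K) := Finset.card_le_univ _
      _ = q ^ (2 * m - k) := by rw [Fintype.card_fun, hTc]
  let a : Fin m ⊕ Fin m := Sum.inl k
  -- A vector of the subspace with w·w = 2 ≠ 0, so that the form is a genuine quadratic along every
  -- line in direction w.
  let w : Fin m ⊕ Fin m → K := fun x => if x = a ∨ x = plusRev m a then 1 else 0
  have hww : ∑ x, w x * w (plusRev m x) = 2 := by
    have h3 : ∀ x, w x * w (plusRev m x) = w x := by
      intro x
      have h4 : (plusRev m x = a ∨ plusRev m x = plusRev m a) ↔ (x = a ∨ x = plusRev m a) := by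
        rw [plusRev_involutive.injective.eq_iff, or_comm, plusRev_involutive.eq_iff]
      simp only [w, h4]
      split_ifs <;> simp
    rw [Finset.sum_congr rfl fun x _ => h3 x, Finset.sum_boole]
    have h5 : (Finset.univ.filter fun x => x = a ∨ x = plusRev m a) = {a, plusRev m a} := by
      ext x; simp
    rw [h5, Finset.card_pair (by simp [a, plusRev])]
    norm_num
  have hwV : ∀ i < k, w (Sum.inr i.rev) = 0 := by
    intro i hi
    have : i ≠ k := hi.ne
    simp [w, a, plusRev, this]
  -- In (v, t) ↦ v + t w, a fibre over u consists of roots t of a quadratic, so it has at most two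
  -- points.
  have key : X.card * q ≤ 2 * V.card := by
    let f : (Fin m ⊕ Fin m → K) × K → (Fin m ⊕ Fin m → K) := fun p x => p.1 x + p.2 * w x
    have h3 := Finset.card_le_mul_card_image (f := f) (X ×ˢ (Finset.univ : Finset K)) 2 (by
      intro u _
      obtain ⟨b, c, hbc⟩ : ∃ b c : K, ∀ t : K, ∑ x, (u x - t * w x) *
          (u (plusRev m x) - t * w (plusRev m x)) = 2 * t ^ 2 + b * t + c := by
        refine ⟨-∑ x, (u x * w (plusRev m x) + w x * u (plusRev m x)),
          ∑ x, u x * u (plusRev m x), fun t => ?_⟩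
        rw [← hww, neg_mul, Finset.sum_mul, Finset.sum_mul, ← Finset.sum_neg_distrib,
          ← Finset.sum_add_distrib, ← Finset.sum_add_distrib]
        exact Finset.sum_congr rfl fun x _ => by ring
      refine le_trans ?_ (card_filter_quadratic_le h2 b c)
      refine Finset.card_le_card_of_injOn Prod.snd ?_ ?_
      · rintro ⟨v, t⟩ hp
        simp only [Finset.coe_filter, Finset.mem_product, Finset.mem_univ, and_true,
          Set.mem_ofPred_eq, true_and] at hp ⊢
        obtain ⟨hv, rfl⟩ := hp
        rw [← hbc]
        simpa [f] using (Finset.mem_filter.1 hv).2.2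
      · rintro ⟨v, t⟩ hp ⟨v', t'⟩ hp' htt
        obtain rfl : t = t' := htt
        have h4 := (Finset.mem_filter.1 hp).2.trans (Finset.mem_filter.1 hp').2.symm
        refine Prod.ext (funext fun x => ?_) rfl
        exact add_right_cancel (congrFun h4 x))
    rw [Finset.card_product, Finset.card_univ] at h3
    refine h3.trans (Nat.mul_le_mul_left 2 (Finset.card_le_card fun u hu => ?_))
    obtain ⟨⟨v, t⟩, hvt, rfl⟩ := Finset.mem_image.1 hu
    have hv := (Finset.mem_filter.1 (Finset.mem_product.1 hvt).1).2.1
    refine Finset.mem_filter.2 ⟨Finset.mem_univ _, fun i hi => ?_⟩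
    have hv' : v (Sum.inr i.rev) = 0 := hv i hi
    simp [f, hv', hwV i hi]
  refine Nat.le_of_mul_le_mul_right (c := q) ?_ hq0
  calc X.card * q ≤ 2 * V.card := key
    _ ≤ 2 * q ^ (2 * m - k) := Nat.mul_le_mul_left 2 hVc
    _ = 2 * q ^ (2 * m - k - 1) * q := by
        rw [mul_assoc, ← pow_succ]; congr 2; omega

/-- `A` fixes the first `k` basis vectors. -/
def FixesFirst (k : ℕ) (A : plusOrthogonalGroup m K) : Prop :=
  ∀ i : Fin m, (i : ℕ) < k → ∀ x, plusMat A x (Sum.inl i) =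
    (1 : Matrix (Fin m ⊕ Fin m) (Fin m ⊕ Fin m) K) x (Sum.inl i)

open Classical in
-- Orbit counting: the image of basis vector k is isotropic and orthogonal to the first k basis
-- vectors, and elements with the same image differ by one that fixes k + 1 vectors.
theorem card_fixesFirst_le [Fintype K] (h2 : (2 : K) ≠ 0) (k : Fin m) :
    (Finset.univ.filter fun A : plusOrthogonalGroup m K => FixesFirst k A).card ≤
      2 * Fintype.card K ^ (2 * m - k - 1) *
        (Finset.univ.filter fun A : plusOrthogonalGroup m K => FixesFirst (k + 1) A).card := by
  let f : plusOrthogonalGroup m K → (Fin m ⊕ Fin m → K) := fun A x => plusMat A x (Sum.inl k)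
  set S := Finset.univ.filter fun A : plusOrthogonalGroup m K => FixesFirst k A with hS
  have h1 := Finset.card_le_mul_card_image (f := f) S
    (Finset.univ.filter fun A : plusOrthogonalGroup m K => FixesFirst (k + 1) A).card (by
    intro v hv
    obtain ⟨A₀, hA₀, rfl⟩ := Finset.mem_image.1 hv
    have hA₀' := (Finset.mem_filter.1 hA₀).2
    refine Finset.card_le_card_of_injOn (fun A => A₀⁻¹ * A) ?_ fun A _ B _ h => mul_left_cancel h
    intro A hA
    obtain ⟨hA1, hA2⟩ := Finset.mem_filter.1 hA
    have hA3 := (Finset.mem_filter.1 hA1).2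
    refine Finset.mem_coe.2 (Finset.mem_filter.2 ⟨Finset.mem_univ _, fun i hi x => ?_⟩)
    have hcol : ∀ y, plusMat A y (Sum.inl i) = plusMat A₀ y (Sum.inl i) := by
      intro y
      rcases Nat.lt_succ_iff_lt_or_eq.1 hi with hlt | heq
      · rw [hA3 i hlt y, hA₀' i hlt y]
      · rw [Fin.ext heq]
        exact congrFun hA2 y
    rw [← plusMat_one, ← inv_mul_cancel A₀, plusMat_mul, plusMat_mul, Matrix.mul_apply,
      Matrix.mul_apply]
    exact Finset.sum_congr rfl fun y _ => by rw [hcol])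
  refine h1.trans ?_
  rw [mul_comm]
  refine Nat.mul_le_mul_right _ (le_trans (Finset.card_le_card fun v hv => ?_)
    (card_isotropic_le h2 k))
  obtain ⟨A, hA, rfl⟩ := Finset.mem_image.1 hv
  have hA' := (Finset.mem_filter.1 hA).2
  refine Finset.mem_filter.2 ⟨Finset.mem_univ _, fun i hi => ?_, ?_⟩
  · have h3 := plusMat_apply_mul_apply A (Sum.inl i) (Sum.inl k)
    rw [if_neg (by simp [plusRev])] at h3
    simp only [hA' i hi, Matrix.one_apply, ite_mul, one_mul, zero_mul, Finset.sum_ite_eq',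
      Finset.mem_univ, if_true] at h3
    exact h3
  · have h3 := plusMat_apply_mul_apply A (Sum.inl k) (Sum.inl k)
    rwa [if_neg (by simp [plusRev])] at h3

open Classical in
-- Fixing the first half of the basis leaves only the upper right block free. After reversal it is
-- skew-symmetric, with zero diagonal as 2 ≠ 0.
theorem card_fixesFirst_self_le [Fintype K] (h2 : (2 : K) ≠ 0) :
    (Finset.univ.filter fun A : plusOrthogonalGroup m K => FixesFirst m A).card ≤
      Fintype.card K ^ Fintype.card (StrictPairs m) := by
  let F : plusOrthogonalGroup m K → (StrictPairs m → K) := fun A p =>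
    plusMat A (Sum.inl p.1.1.rev) (Sum.inr p.1.2)
  have hone : ∀ A : plusOrthogonalGroup m K, FixesFirst m A → ∀ i j,
      plusMat A (Sum.inr i) (Sum.inr j) = if i = j then 1 else 0 := by
    intro A hA i j
    have h3 := plusMat_apply_mul_apply A (Sum.inl i.rev) (Sum.inr j)
    simp only [hA _ (Fin.is_lt _), Matrix.one_apply, ite_mul, one_mul, zero_mul,
      Finset.sum_ite_eq', Finset.mem_univ, if_true] at h3
    simpa [plusRev, eq_comm] using h3
  have hskew : ∀ A : plusOrthogonalGroup m K, FixesFirst m A → ∀ i j,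
      plusMat A (Sum.inl j.rev) (Sum.inr i) + plusMat A (Sum.inl i.rev) (Sum.inr j) = 0 := by
    intro A hA i j
    have h3 := plusMat_apply_mul_apply A (Sum.inr i) (Sum.inr j)
    rw [if_neg (by simp [plusRev]), Fintype.sum_sum_type] at h3
    simp only [plusRev, Sum.elim_inl, Sum.elim_inr, hone A hA] at h3
    have h4 : ∀ x : Fin m, (x.rev = j) = (x = j.rev) := fun x => propext
      ⟨fun h => by rw [← h, Fin.rev_rev], fun h => by rw [h, Fin.rev_rev]⟩
    simpa [h4] using h3
  have hinj : Set.InjOn F (Finset.univ.filter fun A : plusOrthogonalGroup m K => FixesFirst m A) := by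
    intro A hA B hB h
    have hA' := (Finset.mem_filter.1 hA).2
    have hB' := (Finset.mem_filter.1 hB).2
    have hlt : ∀ i j : Fin m, i < j → plusMat A (Sum.inl i.rev) (Sum.inr j) =
        plusMat B (Sum.inl i.rev) (Sum.inr j) := fun i j hij => congrFun h ⟨(i, j), hij⟩
    have hall : ∀ i j : Fin m, plusMat A (Sum.inl i.rev) (Sum.inr j) =
        plusMat B (Sum.inl i.rev) (Sum.inr j) := by
      intro i j
      rcases lt_trichotomy i j with hij | rfl | hij
      · exact hlt i j hij
      · have hz : ∀ A : plusOrthogonalGroup m K, FixesFirst m A →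
            plusMat A (Sum.inl i.rev) (Sum.inr i) = 0 := by
          intro A hA
          have := hskew A hA i i
          rw [← two_mul] at this
          exact (mul_eq_zero.1 this).resolve_left h2
        rw [hz A hA', hz B hB']
      · rw [eq_neg_of_add_eq_zero_right (hskew A hA' i j),
          eq_neg_of_add_eq_zero_right (hskew B hB' i j), hlt j i hij]
    apply plusMat_injective
    ext x y
    rcases y with j | j
    · rw [hA' j j.2, hB' j j.2]
    · rcases x with i | i
      · have := hall i.rev j
        rwa [Fin.rev_rev] at this
      · rw [hone A hA', hone B hB']
  calc _ = (Finset.image F _).card := (Finset.card_image_of_injOn hinj).symm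
    _ ≤ Fintype.card (StrictPairs m → K) := Finset.card_le_univ _
    _ = _ := by rw [Fintype.card_fun]

/-- Multiply the bounds along the stabilizer chain. With P strict pairs the chain gives exponent m²
+ P, its end gives P, and m² = m + 2P. The chain also costs a factor 2 per step. -/
theorem card_plusOrthogonalGroup_le [Fintype K] (h2 : (2 : K) ≠ 0) :
    Fintype.card (plusOrthogonalGroup m K) ≤
      2 ^ m * Fintype.card K ^ (m + 4 * Fintype.card (StrictPairs m)) := by
  classical
  set q := Fintype.card K with hq
  have main : ∀ k ≤ m, Fintype.card (plusOrthogonalGroup m K) ≤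
      2 ^ k * q ^ (∑ i ∈ Finset.range k, (2 * m - i - 1)) *
        (Finset.univ.filter fun A : plusOrthogonalGroup m K => FixesFirst k A).card := by
    intro k
    induction k with
    | zero =>
      intro _
      have : (Finset.univ.filter fun A : plusOrthogonalGroup m K => FixesFirst 0 A) =
          Finset.univ := Finset.filter_true_of_mem fun A _ i hi => absurd hi (Nat.not_lt_zero _)
      rw [this]
      simp
    | succ k ih =>
      intro hk
      refine (ih (by omega)).trans ?_
      calc _ ≤ 2 ^ k * q ^ (∑ i ∈ Finset.range k, (2 * m - i - 1)) * (2 * q ^ (2 * m - k - 1) *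
              (Finset.univ.filter fun A : plusOrthogonalGroup m K => FixesFirst (k + 1) A).card) :=
            Nat.mul_le_mul_left _ (card_fixesFirst_le h2 ⟨k, hk⟩)
        _ = _ := by rw [Finset.sum_range_succ, pow_add, pow_succ]; ring
  refine (main m le_rfl).trans ?_
  refine (Nat.mul_le_mul_left _ (card_fixesFirst_self_le h2)).trans (le_of_eq ?_)
  rw [mul_assoc, ← pow_add]
  congr 2
  have h3 : ∑ i ∈ Finset.range m, (2 * m - i - 1) = m * m + ∑ k ∈ Finset.range m, k := by
    rw [← Finset.sum_range_reflect]
    calc _ = ∑ j ∈ Finset.range m, (m + j) := Finset.sum_congr rfl fun j hj => by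
          have := Finset.mem_range.1 hj; omega
      _ = _ := by rw [Finset.sum_add_distrib]; simp
  have h4 := Finset.sum_range_id_mul_two m
  rw [h3, card_strictPairs]
  rcases m with _ | m
  · simp
  · rw [Nat.add_sub_cancel] at h4
    nlinarith

end PlusCount

/-! ### DFTs of the unipotent radical, the Borel subgroup and the orthogonal group -/

section PlusFastDFT

variable {m : ℕ} {K : Type} [Field K]

/-- The least power of p that is at least 2m overshoots by less than a factor p. -/
theorem exists_pow_eq_one_of_mem_plusUnipotent (p : ℕ) [hp : Fact p.Prime] [CharP K p] :
    ∃ k, p ^ k ≤ (2 * m + 1) * p ∧ ∀ u ∈ plusUnipotent m K, u ^ p ^ k = 1 := by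
  refine ⟨Nat.clog p (2 * m), ?_, fun u hu => ?_⟩
  · rcases Nat.lt_or_ge 1 (2 * m) with h | h
    · have h1 := Nat.pow_pred_clog_lt_self hp.out.one_lt h
      have h2 : 0 < Nat.clog p (2 * m) := Nat.clog_pos hp.out.one_lt h
      calc p ^ Nat.clog p (2 * m) = p ^ (Nat.clog p (2 * m)).pred * p := by
            rw [← pow_succ]; congr 1; exact (Nat.succ_pred_eq_of_pos h2).symm
        _ ≤ (2 * m + 1) * p := Nat.mul_le_mul_right _ (by omega)
    · rw [Nat.clog_of_right_le_one h, pow_zero]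
      exact Nat.mul_pos (Nat.succ_pos _) hp.out.pos
  · apply plusMat_injective
    rw [plusMat_pow, plusMat_one]
    exact (mem_plusUnipotent.1 hu).pow_prime_pow_eq_one p fun x =>
      (plusPos_lt x).trans_le (Nat.le_pow_clog hp.out.one_lt _)

theorem fastDFT_plusUnipotent [Fintype K] [Fintype (plusUnipotent m K)] {b α C : ℝ}
    (hM : MatMulBound b (2 * α)) (hC : 0 ≤ C)
    (hcyc : ∀ (G : Type) [Group G] [Fintype G] [IsCyclic G],
      FastDFT G (C * (Fintype.card G : ℝ) ^ α)) :
    FastDFT (plusUnipotent m K) ((C + 2 * Real.log (Fintype.card (plusUnipotent m K)) *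
      ((C + 2 * b) * (2 * m + 1) ^ α + 7 * b + 1)) *
        (Fintype.card (plusUnipotent m K) : ℝ) ^ α) := by
  obtain ⟨p, hp⟩ := CharP.exists K
  have : Fact p.Prime := ⟨CharP.char_is_prime K p⟩
  have hb := hM.nonneg
  obtain ⟨k, hk, hpow⟩ := exists_pow_eq_one_of_mem_plusUnipotent (m := m) (K := K) p
  have hpow' : ∀ u : plusUnipotent m K, u ^ p ^ k = 1 := fun u => Subtype.ext (hpow u u.2)
  have hP : IsPGroup p (plusUnipotent m K) := fun u => ⟨k, hpow' u⟩
  obtain ⟨n, hn⟩ := IsPGroup.iff_card.1 hP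
  rw [Nat.card_eq_fintype_card] at hn
  refine (fastDFT_pGroup (M := 2 * m + 1) hM hC (by positivity) hcyc n _ hn fun u => ?_).mono ?_
  · have h1 : orderOf u ≤ (2 * m + 1) * p :=
      (orderOf_le_of_pow_eq_one (pow_pos (Fact.out : p.Prime).pos k) (hpow' u)).trans hk
    exact_mod_cast h1
  · have h1 : (n : ℝ) ≤ 2 * Real.log (Fintype.card (plusUnipotent m K)) := by
      have h2 : Real.log 2 ≤ Real.log p :=
        Real.log_le_log two_pos (by exact_mod_cast (Fact.out : p.Prime).two_le)
      have h3 := Real.log_two_gt_d9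
      rw [hn, Nat.cast_pow, Real.log_pow]
      nlinarith [(Nat.cast_nonneg n : (0 : ℝ) ≤ n)]
    have h2 : (0 : ℝ) ≤ (2 * m + 1 : ℝ) ^ α := by positivity
    gcongr

theorem fastDFT_plusTorus [Fintype Kˣ] {b α C : ℝ} (hM : MatMulBound b (2 * α)) (hC : 0 ≤ C)
    (hcyc : ∀ (G : Type) [Group G] [Fintype G] [IsCyclic G],
      FastDFT G (C * (Fintype.card G : ℝ) ^ α)) :
    FastDFT (Fin m → Kˣ) ((C + m * (C + 9 * b + 1)) * (Fintype.card (Fin m → Kˣ) : ℝ) ^ α) :=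
  fastDFT_pi hM hC (hcyc Kˣ) (hcyc _) m

theorem card_torus_mul_card_unipotent [Fintype Kˣ] [Fintype (plusUnipotent m K)]
    [Fintype (plusBorel m K)] : Fintype.card (Fin m → Kˣ) * Fintype.card (plusUnipotent m K) =
      Fintype.card (plusBorel m K) := by
  rw [← Fintype.card_prod]
  let F : (Fin m → Kˣ) × plusUnipotent m K → plusBorel m K := fun p =>
    ⟨plusTorus m K p.1 * p.2, mul_mem (plusTorus_mem_plusBorel _) (plusUnipotent_le_plusBorel p.2.2)⟩
  refine Fintype.card_of_bijective (f := F) ⟨?_, ?_⟩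
  · rintro ⟨t, u⟩ ⟨t', u'⟩ h
    have h1 : plusTorus m K t * u = plusTorus m K t' * u' := congrArg Subtype.val h
    obtain rfl := torus_mul_unipotent_injective u.2 u'.2 h1
    rw [Subtype.ext (mul_left_cancel h1)]
  · rintro ⟨A, hA⟩
    obtain ⟨t, u, hu, rfl⟩ := exists_torus_mul_unipotent hA
    exact ⟨(t, ⟨u, hu⟩), rfl⟩

/-- B = TU exactly, so one cell suffices and there is no loss in |H||K|. -/
theorem fastDFT_plusBorel [Fintype Kˣ] [Fintype (plusUnipotent m K)] [Fintype (plusBorel m K)]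
    {b α cT cU : ℝ} (hM : MatMulBound b (2 * α)) (hcT : 0 ≤ cT) (hcU : 0 ≤ cU)
    (hT : FastDFT (Fin m → Kˣ) (cT * (Fintype.card (Fin m → Kˣ) : ℝ) ^ α))
    (hU : FastDFT (plusUnipotent m K) (cU * (Fintype.card (plusUnipotent m K) : ℝ) ^ α)) :
    FastDFT (plusBorel m K) ((cU + cT + 9 * b + 1) *
      (Fintype.card (plusBorel m K) : ℝ) ^ α) := by
  have hcard := card_torus_mul_card_unipotent (m := m) (K := K)
  have h := FastDFT.of_cover_of_card_le (W := Unit)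
    ((plusTorus m K).codRestrict (plusBorel m K) plusTorus_mem_plusBorel)
    (Subgroup.inclusion (plusUnipotent_le_plusBorel (m := m) (K := K))) Finset.univ
    (fun _ => 1) (fun _ => 1) (M := 1) (fun g => by
      obtain ⟨t, u, hu, h⟩ := exists_torus_mul_unipotent g.2
      refine ⟨(), t, Finset.mem_univ _, ⟨u, hu⟩, Subtype.ext ?_⟩
      simpa using h) hM hT hU hcT hcU (by rw [Finset.card_univ, hcard])
    (by rw [one_mul]; exact_mod_cast hcard.le) zero_le_one
  refine h.mono (le_of_eq ?_)
  rw [Real.one_rpow, Fintype.card_unit]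
  push_cast
  ring

/-- The big cell has |B||U| ≥ |G|/N elements, so about N log |G| of its translates cover the group,
each with the cost of one factorization. -/
theorem fastDFT_plusOrthogonalGroup_of_borel [Fintype K] [Fintype (plusUnipotent m K)]
    [Fintype (plusBorel m K)]
    {b α cB cU N : ℝ} (hM : MatMulBound b (2 * α)) (hcB : 0 ≤ cB) (hcU : 0 ≤ cU)
    (hB : FastDFT (plusBorel m K) (cB * (Fintype.card (plusBorel m K) : ℝ) ^ α))
    (hU : FastDFT (plusUnipotent m K) (cU * (Fintype.card (plusUnipotent m K) : ℝ) ^ α))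
    (hN : (Fintype.card (plusOrthogonalGroup m K) : ℝ) ≤
      N * (Fintype.card (plusBorel m K) * Fintype.card (plusUnipotent m K))) :
    FastDFT (plusOrthogonalGroup m K)
      ((N * Real.log (Fintype.card (plusOrthogonalGroup m K)) + 1) * (cU + cB + 9 * b + 1) *
        (Fintype.card (plusOrthogonalGroup m K) : ℝ) ^ α) := by
  classical
  have hb := hM.nonneg
  let F : plusBorel m K × plusUnipotent m K → plusOrthogonalGroup m K := fun p =>
    p.1 * plusReversal m K * p.2
  have hF : Function.Injective F := by
    rintro ⟨⟨x, hx⟩, ⟨u, hu⟩⟩ ⟨⟨x', hx'⟩, ⟨u', hu'⟩⟩ h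
    have h1 : x * plusReversal m K * u = x' * plusReversal m K * u' := h
    have h2 : u * u'⁻¹ = 1 := by
      refine plusBorel_inter_opposite (mul_mem (inv_mem hx) hx') (mul_mem hu (inv_mem hu')) ?_
      rw [inv_mul_eq_iff_eq_mul]
      calc x' = x' * plusReversal m K * u' * u'⁻¹ * (plusReversal m K)⁻¹ := by group
        _ = _ := by rw [← h1]; group
    obtain rfl := mul_inv_eq_one.1 h2
    obtain rfl := mul_right_cancel (mul_right_cancel h1)
    rfl
  set S := Finset.univ.image F with hS
  have hSc : S.card = Fintype.card (plusBorel m K) * Fintype.card (plusUnipotent m K) := by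
    rw [hS, Finset.card_image_of_injective _ hF, Finset.card_univ, Fintype.card_prod]
  have hSne : S.Nonempty := ⟨F 1, Finset.mem_image_of_mem _ (Finset.mem_univ _)⟩
  have hS0 : (0 : ℝ) < S.card := by exact_mod_cast hSne.card_pos
  have hle : Fintype.card (plusBorel m K) * Fintype.card (plusUnipotent m K) ≤
      Fintype.card (plusOrthogonalGroup m K) := hSc ▸ S.card_le_univ
  obtain ⟨T, hT, hTc⟩ := exists_translates_cover S hSne
  have h := FastDFT.of_cover_of_card_le (W := T) (plusBorel m K).subtype (plusUnipotent m K).subtype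
    Finset.univ (fun t => t.1) (fun _ => plusReversal m K) (M := 1) (fun g => by
      obtain ⟨t, ht, hg⟩ := hT g
      obtain ⟨⟨x, u⟩, -, h⟩ := Finset.mem_image.1 hg
      refine ⟨⟨t, ht⟩, x, Finset.mem_univ _, u, ?_⟩
      have h1 : (x : plusOrthogonalGroup m K) * plusReversal m K * u = t⁻¹ * g := h
      rw [Subgroup.subtype_apply, Subgroup.subtype_apply, mul_assoc t, mul_assoc t, h1,
        mul_inv_cancel_left]) hM hB hU hcB hcU (by rwa [Finset.card_univ])
    (by rw [one_mul]; exact_mod_cast hle) zero_le_one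
  refine h.mono ?_
  rw [Real.one_rpow, Fintype.card_coe,
    show cU + (cB + 2 * b) * 1 + 7 * b + 1 = cU + cB + 9 * b + 1 by ring]
  have hlog : 0 ≤ Real.log (Fintype.card (plusOrthogonalGroup m K)) := Real.log_natCast_nonneg _
  have h1 : (Fintype.card (plusOrthogonalGroup m K) : ℝ) / S.card ≤ N := by
    rw [div_le_iff₀ hS0, hSc]
    exact_mod_cast hN
  gcongr
  exact hTc.trans (by gcongr)

/-- |U| ≥ q^(2P) matches the power of q in the upper bound for |G|. What remains is 2q against q -
1, and 2q ≤ 3(q - 1) for q ≥ 3. -/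
theorem card_plusOrthogonalGroup_le_three_pow [Fintype K] [Fintype (plusUnipotent m K)]
    [Fintype (plusBorel m K)] (h2 : (2 : K) ≠ 0) (hK : 3 ≤ Fintype.card K) :
    Fintype.card (plusOrthogonalGroup m K) ≤
      3 ^ m * (Fintype.card (plusBorel m K) * Fintype.card (plusUnipotent m K)) := by
  classical
  have hU := card_plusUnipotent_ge (m := m) (K := K)
  rw [Nat.card_eq_fintype_card] at hU
  rw [← card_torus_mul_card_unipotent, Fintype.card_fun, Fintype.card_units, Fintype.card_fin]
  refine (card_plusOrthogonalGroup_le h2).trans ?_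
  set q := Fintype.card K
  set P := Fintype.card (StrictPairs m)
  set u := Fintype.card (plusUnipotent m K)
  calc 2 ^ m * q ^ (m + 4 * P) = (2 * q) ^ m * (q ^ (2 * P) * q ^ (2 * P)) := by
        rw [mul_pow, ← pow_add, pow_add]; ring
    _ ≤ (3 * (q - 1)) ^ m * (u * u) :=
        Nat.mul_le_mul (Nat.pow_le_pow_left (by omega) m) (Nat.mul_le_mul hU hU)
    _ = _ := by rw [mul_pow]; ring

/-- The unipotent radical alone is this large. Growth quadratic in m in the exponent is what absorbs
the factor 3^m. -/
theorem three_rpow_le_card_plusOrthogonalGroup [Fintype K] (hK : 3 ≤ Fintype.card K) :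
    (3 : ℝ) ^ ((m : ℝ) * (m - 1)) ≤ Fintype.card (plusOrthogonalGroup m K) := by
  have h1 : 3 ^ (2 * Fintype.card (StrictPairs m)) ≤ Fintype.card (plusOrthogonalGroup m K) :=
    calc _ ≤ Fintype.card K ^ (2 * Fintype.card (StrictPairs m)) := Nat.pow_le_pow_left hK _
      _ ≤ _ := card_plusUnipotent_ge
      _ ≤ _ := by
        rw [← Nat.card_eq_fintype_card]
        exact Nat.card_le_card_of_injective _ Subtype.val_injective
  have h2 : (m : ℝ) * (m - 1) = (2 * Fintype.card (StrictPairs m) : ℕ) := by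
    have h3 := Finset.sum_range_id_mul_two m
    rw [card_strictPairs, mul_comm 2, h3]
    rcases m with _ | m <;> simp
  rw [h2, Real.rpow_natCast]
  exact_mod_cast h1

/-- Subexponential factors are absorbed by a small power of a quantity growing like `3 ^ m²`. -/
theorem three_pow_mul_rpow_le {α δ x : ℝ} (hα : 0 ≤ α) (hδ : 0 < δ) {m : ℕ}
    (hx : (3 : ℝ) ^ ((m : ℝ) * (m - 1)) ≤ x) :
    3 ^ m * (2 * m + 1 : ℝ) ^ α ≤ 3 ^ ((1 + α + δ) ^ 2 / (4 * δ)) * x ^ δ := by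
  have h1 : (2 * m + 1 : ℝ) ≤ 3 ^ (m : ℝ) := by
    have h := one_add_mul_le_pow (show (-2 : ℝ) ≤ 2 by norm_num) m
    rw [Real.rpow_natCast]
    norm_num at h
    linarith
  have h3 : (0 : ℝ) < 3 := by norm_num
  calc 3 ^ m * (2 * m + 1 : ℝ) ^ α ≤ 3 ^ (m : ℝ) * (3 ^ (m : ℝ)) ^ α := by
        rw [← Real.rpow_natCast]; gcongr
    _ = 3 ^ ((1 + α) * m : ℝ) := by
        rw [← Real.rpow_mul h3.le, ← Real.rpow_add h3]; congr 1; ring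
    _ ≤ 3 ^ ((1 + α + δ) ^ 2 / (4 * δ) + m * (m - 1) * δ) := by
        -- The constant is the maximum over m of (1 + α + δ)m - δm², found by completing the square.
        refine Real.rpow_le_rpow_of_exponent_le (by norm_num) ?_
        rw [← sub_le_iff_le_add, le_div_iff₀ (by positivity)]
        nlinarith [sq_nonneg (1 + α + δ - 2 * δ * m)]
    _ = 3 ^ ((1 + α + δ) ^ 2 / (4 * δ)) * ((3 : ℝ) ^ ((m : ℝ) * (m - 1))) ^ δ := by
        rw [Real.rpow_add h3, ← Real.rpow_mul h3.le]
    _ ≤ _ := by gcongr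

theorem log_add_one_sq_le {δ x : ℝ} (hδ : 0 < δ) (hx : 1 ≤ x) :
    (Real.log x + 1) ^ 2 ≤ (1 / δ + 1) ^ 2 * x ^ (2 * δ) := by
  have h0 := Real.log_nonneg hx
  have h1 := Real.log_le_rpow_div (zero_le_one.trans hx) hδ
  have h2 := Real.one_le_rpow hx hδ.le
  rw [mul_comm 2 δ, Real.rpow_mul (by linarith), Real.rpow_two, ← mul_pow]
  gcongr
  calc _ ≤ x ^ δ / δ + x ^ δ := add_le_add h1 h2
    _ = _ := by ring

theorem exists_fastDFT_plusOrthogonalGroup {ε : ℝ} (hε : 0 < ε) :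
    ∃ c : ℝ, ∀ (m : ℕ) (K : Type) [Field K] [Fintype K], Odd (Fintype.card K) →
      FastDFT (plusOrthogonalGroup m K)
        (c * (Fintype.card (plusOrthogonalGroup m K) : ℝ) ^ (omega / 2 + ε)) := by
  classical
  obtain ⟨b, hM'⟩ := exists_matMulBound hε
  -- Half of ε goes into α, which with ω ≥ 2 also makes α > 1, as the FFT bound requires.
  obtain ⟨α, hα⟩ : ∃ α, α = omega / 2 + ε / 2 := ⟨_, rfl⟩
  have hM : MatMulBound b (2 * α) := by
    rwa [show 2 * α = omega + ε by rw [hα]; ring]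
  have hb := hM.nonneg
  have hω := two_le_omega
  have hα1 : 1 < α := by rw [hα]; linarith
  obtain ⟨C, hC, hcyc⟩ := exists_fastDFT_cyclic hα1
  set E := C + 9 * b + 1 with hE
  have hE1 : 0 ≤ E := by positivity
  -- The overhead costs g^(2δ) for the factors in m and g^(2δ) for the two logarithms, together
  -- g^(ε/2).
  set δ := ε / 8 with hδ
  have hδ0 : 0 < δ := by positivity
  refine ⟨7 * E * 3 ^ ((1 + α + 2 * δ) ^ 2 / (4 * (2 * δ))) * (1 / δ + 1) ^ 2,
    fun m K _ _ hodd => ?_⟩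
  have hK1 : 1 < Fintype.card K := Fintype.one_lt_card
  have hK : 3 ≤ Fintype.card K := by
    obtain ⟨k, hk⟩ := hodd
    omega
  have h2 : (2 : K) ≠ 0 := by
    refine Ring.two_ne_zero fun h => ?_
    have := FiniteField.even_card_iff_char_two.1 h
    have := Nat.odd_iff.1 hodd
    omega
  have : Fintype (plusUnipotent m K) := Fintype.ofFinite _
  have : Fintype (plusBorel m K) := Fintype.ofFinite _
  set g : ℝ := (Fintype.card (plusOrthogonalGroup m K) : ℝ) with hg
  have hg1 : 1 ≤ g := by rw [hg]; exact_mod_cast Fintype.card_pos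
  have hL : 0 ≤ Real.log g := Real.log_nonneg hg1
  set X : ℝ := (2 * m + 1 : ℝ) ^ α with hX
  have hmX : (2 * m + 1 : ℝ) ≤ X := by
    simpa using Real.rpow_le_rpow_of_exponent_le
      (show (1 : ℝ) ≤ 2 * m + 1 by linarith [(Nat.cast_nonneg m : (0 : ℝ) ≤ m)]) hα1.le
  have hm0 : (0 : ℝ) ≤ m := Nat.cast_nonneg m
  set cU := C + 2 * Real.log g * ((C + 2 * b) * X + 7 * b + 1) with hcU
  set cT := C + m * (C + 9 * b + 1) with hcT
  have hX0 : 0 ≤ X := by linarith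
  have hcU0 : 0 ≤ cU := by positivity
  have hcT0 : 0 ≤ cT := by positivity
  have hU : FastDFT (plusUnipotent m K)
      (cU * (Fintype.card (plusUnipotent m K) : ℝ) ^ α) := by
    refine (fastDFT_plusUnipotent hM hC hcyc).mono ?_
    have h3 : Real.log (Fintype.card (plusUnipotent m K)) ≤ Real.log g := by
      refine Real.log_le_log (by exact_mod_cast Fintype.card_pos) ?_
      rw [hg]
      exact_mod_cast Fintype.card_le_of_injective _ Subtype.val_injective
    rw [hcU]
    gcongr
  have hT := fastDFT_plusTorus (m := m) (K := K) hM hC hcyc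
  have hB := fastDFT_plusBorel hM hcT0 hcU0 hT hU
  refine (fastDFT_plusOrthogonalGroup_of_borel (N := 3 ^ m) hM (by positivity) hcU0 hB hU
    (by exact_mod_cast card_plusOrthogonalGroup_le_three_pow h2 hK)).mono ?_
  rw [show omega / 2 + ε = δ * 2 + 2 * δ + α by rw [hδ, hα]; ring]
  have hΛ : (0 : ℝ) ≤ Real.log g + 1 := by linarith
  -- The logarithm here is the chain length of the unipotent radical; the other one comes from the
  -- number of translates.
  have hcost : cU + (cU + cT + 9 * b + 1) + 9 * b + 1 ≤ 7 * E * X * (Real.log g + 1) := by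
    have hXE : E ≤ E * X := le_mul_of_one_le_right hE1 (by linarith)
    have h3 : (C + 2 * b) * X + 7 * b + 1 ≤ E * X := by
      rw [hE]; nlinarith
    have h4 : cU ≤ E * X * (1 + 2 * Real.log g) := by
      rw [hcU]
      have := mul_le_mul_of_nonneg_left h3 (mul_nonneg zero_le_two hL)
      have hCE : C ≤ E := by rw [hE]; linarith
      linarith
    have h5 : cT ≤ E * X := by
      rw [hcT, ← hE]
      have : E * (2 * m + 1) ≤ E * X := mul_le_mul_of_nonneg_left hmX hE1
      have hCE : C ≤ E := by rw [hE]; linarith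
      have := mul_nonneg hm0 hE1
      linarith
    have h6 : 9 * b + 1 ≤ E * X := by linarith
    have h7 : 0 ≤ E * X * Real.log g := by positivity
    linarith
  have h3m : (1 : ℝ) ≤ 3 ^ m := one_le_pow₀ (by norm_num)
  calc _ ≤ (3 ^ m * (Real.log g + 1)) * (7 * E * X * (Real.log g + 1)) * g ^ α := by
        gcongr
        linarith
    _ = 7 * E * (3 ^ m * X) * (Real.log g + 1) ^ 2 * g ^ α := by ring
    _ ≤ 7 * E * (3 ^ ((1 + α + 2 * δ) ^ 2 / (4 * (2 * δ))) * g ^ (2 * δ)) *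
          ((1 / δ + 1) ^ 2 * g ^ (2 * δ)) * g ^ α := by
        refine mul_le_mul_of_nonneg_right (mul_le_mul (mul_le_mul_of_nonneg_left ?_ (by positivity))
          ?_ (by positivity) (by positivity)) (by positivity)
        · exact three_pow_mul_rpow_le (by linarith) (by positivity)
            (three_rpow_le_card_plusOrthogonalGroup hK)
        · exact log_add_one_sq_le hδ0 hg1
    _ = _ := by
        have hadd : g ^ (δ * 2 + 2 * δ + α) = g ^ (2 * δ) * g ^ (2 * δ) * g ^ α := by
          rw [mul_comm δ 2, Real.rpow_add (by linarith), Real.rpow_add (by linarith)]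
        rw [hadd]
        ring

end PlusFastDFT

theorem theorem5p7 :
    ∀ ε : ℝ, 0 < ε → ∃ c : ℝ, ∀ (m : ℕ) (K : Type) [Field K] [Fintype K], Odd (Fintype.card K) →
      Nonempty (GenDFT.IrrepSystem (GenDFT.plusOrthogonalGroup m K)) ∧
      ∀ R : GenDFT.IrrepSystem (GenDFT.plusOrthogonalGroup m K),
        ∃ s : ℕ,
          (s : ℝ) ≤ c * (Nat.card (GenDFT.plusOrthogonalGroup m K) : ℝ) ^ (GenDFT.omega / 2 + ε) ∧
          GenDFT.ComputableWith (GenDFT.dft R) s := by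
  intro ε hε
  obtain ⟨c, hc⟩ := exists_fastDFT_plusOrthogonalGroup hε
  refine ⟨c, fun m K _ _ hodd => ⟨IrrepSystem.nonempty _, fun R => ?_⟩⟩
  rw [Nat.card_eq_fintype_card]
  exact hc m K hodd R
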